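/- All vector spaces are over $\mathbb{C}$. A quadratic Lie superalgebra $(\mathfrak g,B)$ is a Lie superalgebra $\mathfrak g=\mathfrak g_{\bar 0}\oplus\mathfrak g_{\bar 1}$ with an even, supersymmetric, invariant, non-degenerate bilinear form $B$. It is decomposable if it has a graded ideal $I\neq 0,\mathfrak g$ on which $B$ is non-degenerate, and otherwise (if non-zero) indecomposable. An i-isomorphism is an even isomorphism of Lie superalgebras that preserves the forms. A quadratic Lie algebra is the case $\mathfrak g_{\bar 1}=0$; the even part of $(\mathfrak g,B)$, with the restricted form, is one. Let $\mathbb{C}^6$ have the basis $X_1,X_2,X_3,Z_1,Z_2,Z_3$ and the symmetric form with $B(X_i,Z_j)=\delta_{ij}$, $B(X_i,X_j)=B(Z_i,Z_j)=0$. Consider on it the quadratic Lie algebras with the following brackets (those not listed and not obtained by skew-symmetry are zero): - $\mathfrak g_{6,1}$: $[X_1,X_2]=Z_3$, $[X_2,X_3]=Z_1$, $[X_3,X_1]=Z_2$; - $\mathfrak g_{6,2}(\lambda)$, $\lambda\neq0$: $[X_3,Z_1]=Z_1$, $[X_3,Z_2]=\lambda Z_2$, $[X_3,X_1]=-X_1$,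 $[X_3,X_2]=-\lambda X_2$, $[Z_1,X_1]=Z_3$, $[Z_2,X_2]=\lambda Z_3$; - $\mathfrak g_{6,3}$: $[X_3,Z_1]=Z_1$, $[X_3,Z_2]=Z_1+Z_2$, $[X_3,X_1]=-X_1-X_2$, $[X_3,X_2]=-X_2$, $[Z_1,X_1]=[Z_2,X_1]=[Z_2,X_2]=Z_3$. Let further $Y,T$ be a basis of an odd space with $B(Y,T)=1=-B(T,Y)$, $B(Y,Y)=B(T,T)=0$, orthogonal to $\mathbb{C}^6$. Consider the 8-dimensional quadratic Lie superalgebras with the indicated even part and the following brackets involving odd elements (those not listed and not obtained by skew-supersymmetry are zero; all parameters are complex numbers): - $\mathfrak g^s_{8,2,1}(\lambda,\mu,\nu)$, $(\lambda,\mu,\nu)\neq(0,0,0)$, even part $\mathfrak g_{6,1}$: $[X_1,Y]=\lambda Y$, $[X_1,T]=-\lambda T$, $[X_2,Y]=\mu Y$, $[X_2,T]=-\mu T$, $[X_3,Y]=\nu Y$, $[X_3,T]=-\nu T$, $[Y,T]=\lambda Z_1+\mu Z_2+\nu Z_3$; - $\mathfrak g^s_{8,2,2}(\lambda,\mu)$,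 even part $\mathfrak g_{6,1}$: $[X_1,T]=\lambda Y$, $[X_2,T]=\mu Y$, $[X_3,T]=Y$, $[T,T]=\lambda Z_1+\mu Z_2+Z_3$; - $\mathfrak g^s_{8,2,3}(\lambda)$, $\lambda\neq0$, even part $\mathfrak g_{6,2}(\lambda)$: $[X_3,T]=Y$, $[T,T]=Z_3$; - $\mathfrak g^s_{8,2,4}(\lambda,\mu)$, $\lambda,\mu\neq0$, even part $\mathfrak g_{6,2}(\lambda)$: $[X_3,Y]=\mu Y$, $[X_3,T]=-\mu T$, $[Y,T]=\mu Z_3$; - $\mathfrak g^s_{8,2,5}(\lambda)$, $\lambda\neq0$, even part $\mathfrak g_{6,2}(\lambda)$: $[X_3,Y]=\tfrac12Y$, $[X_3,T]=-\tfrac12T$, $[Z_1,T]=Y$, $[Y,T]=\tfrac12Z_3$, $[T,T]=X_1$; - $\mathfrak g^s_{8,2,6}(\lambda,\mu)$, $\lambda=1$, $\mu\neq0$, even part $\mathfrak g_{6,2}(1)$: $[X_3,Y]=\tfrac12Y$, $[X_3,T]=-\tfrac12T$, $[Z_1,T]=Y$, $[Z_2,T]=\mu Y$, $[Y,T]=\tfrac12Z_3$,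 $[T,T]=X_1+\mu X_2$; - $\mathfrak g^s_{8,2,7}$, even part $\mathfrak g_{6,3}$: $[X_3,T]=Y$, $[T,T]=Z_3$; - $\mathfrak g^s_{8,2,8}(\lambda)$, $\lambda\neq0$, even part $\mathfrak g_{6,3}$: $[X_3,Y]=\lambda Y$, $[X_3,T]=-\lambda T$, $[Y,T]=\lambda Z_3$; - $\mathfrak g^s_{8,2,9}$, even part $\mathfrak g_{6,3}$: $[X_3,Y]=\tfrac12Y$, $[X_3,T]=-\tfrac12T$, $[Z_2,T]=Y$, $[Y,T]=\tfrac12Z_3$, $[T,T]=X_2$. **Theorem.** Let $\mathfrak g$ be a solvable quadratic Lie superalgebra of dimension 8 such that its even part is indecomposable (as a quadratic Lie algebra) and 6-dimensional. (i) If $\mathfrak g$ is decomposable, then $\mathfrak g=\mathfrak g_{\bar 0}\overset{\perp}{\oplus}\mathfrak g_{\bar 1}$ is the orthogonal direct sum of the graded ideals $\mathfrak g_{\bar 0}$ and $\mathfrak g_{\bar 1}$, where $\mathfrak g_{\bar 0}$ is i-isomorphic to $\mathfrak g_{6,1}$, to $\mathfrak g_{6,2}(\lambda)$ for some $\lambda\neq0$,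 or to $\mathfrak g_{6,3}$; $\mathfrak g_{\bar 1}$ is a symplectic vector space of dimension 2; and $[\mathfrak g_{\bar 0},\mathfrak g_{\bar 1}]=\{0\}$. (ii) If $\mathfrak g$ is indecomposable, then $\mathfrak g$ is i-isomorphic to one of $\mathfrak g^s_{8,2,1}(\lambda,\mu,\nu)$, $\mathfrak g^s_{8,2,2}(\lambda,\mu)$, $\mathfrak g^s_{8,2,3}(\lambda)$, $\mathfrak g^s_{8,2,4}(\lambda,\mu)$, $\mathfrak g^s_{8,2,5}(\lambda)$, $\mathfrak g^s_{8,2,6}(1,\mu)$, $\mathfrak g^s_{8,2,7}$, $\mathfrak g^s_{8,2,8}(\lambda)$, $\mathfrak g^s_{8,2,9}$, for some values of the parameters in the ranges given above. -/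

import Mathlib

/-! Lie superalgebras over the complex numbers. -/

/-- The sign `(-1)^{xy}` attached to two parities. -/
noncomputable def superSign (x y : ZMod 2) : ℂ := (-1) ^ (x.val * y.val)

/-- A complex Lie superalgebra structure on the vector space `V`: a grading
`V = part 0 ⊕ part 1` together with a super bracket. -/
structure LieSuperalgebra (V : Type*) [AddCommGroup V] [Module ℂ V] where
  /-- the homogeneous components -/
  part : ZMod 2 → Submodule ℂ V
  isCompl : IsCompl (part 0) (part 1)
  /-- the super bracket -/
  bracket : V →ₗ[ℂ] V →ₗ[ℂ] V
  bracket_mem : ∀ x y : ZMod 2, ∀ X ∈ part x, ∀ Y ∈ part y, bracket X Y ∈ part (x + y)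
  skew : ∀ x y : ZMod 2, ∀ X ∈ part x, ∀ Y ∈ part y,
    bracket X Y = -(superSign x y • bracket Y X)
  jacobi : ∀ x y z : ZMod 2, ∀ X ∈ part x, ∀ Y ∈ part y, ∀ Z ∈ part z,
    superSign z x • bracket (bracket X Y) Z + superSign x y • bracket (bracket Y Z) X
      + superSign y z • bracket (bracket Z X) Y = 0

/-- A quadratic Lie superalgebra structure on `V`: a Lie superalgebra with an even, supersymmetric,
invariant, non-degenerate bilinear form. A quadratic Lie algebra is the case `part 1 = ⊥`. -/
structure QuadraticLieSuperalgebra (V : Type*) [AddCommGroup V] [Module ℂ V]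
    extends LieSuperalgebra V where
  /-- the bilinear form -/
  form : V →ₗ[ℂ] V →ₗ[ℂ] ℂ
  supersymm : ∀ x y : ZMod 2, ∀ X ∈ part x, ∀ Y ∈ part y,
    form X Y = superSign x y * form Y X
  invariant : ∀ X Y Z : V, form (bracket X Y) Z = form X (bracket Y Z)
  nondegenerate : ∀ X : V, (∀ Y : V, form X Y = 0) → X = 0
  even : ∀ X ∈ part 0, ∀ Y ∈ part 1, form X Y = 0

namespace LieSuperalgebra

variable {V : Type*} [AddCommGroup V] [Module ℂ V]

/-- The derived series: `𝔤⁽⁰⁾ = 𝔤` and `𝔤⁽ⁿ⁺¹⁾` is the span of all `[X, Y]`, `X, Y ∈ 𝔤⁽ⁿ⁾`. -/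
def derivedSeries (L : LieSuperalgebra V) : ℕ → Submodule ℂ V
  | 0 => ⊤
  | n + 1 => Submodule.map₂ L.bracket (L.derivedSeries n) (L.derivedSeries n)

/-- Solvability: the derived series reaches zero. -/
def IsSolvable (L : LieSuperalgebra V) : Prop := ∃ n : ℕ, L.derivedSeries n = ⊥

/-- Graded ideals. -/
structure IsGradedIdeal (L : LieSuperalgebra V) (I : Submodule ℂ V) : Prop where
  graded : ∀ X₀ ∈ L.part 0, ∀ X₁ ∈ L.part 1, X₀ + X₁ ∈ I → X₀ ∈ I ∧ X₁ ∈ I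
  bracket_mem : ∀ X : V, ∀ Y ∈ I, L.bracket X Y ∈ I

end LieSuperalgebra

namespace QuadraticLieSuperalgebra

variable {V W : Type*} [AddCommGroup V] [Module ℂ V] [AddCommGroup W] [Module ℂ W]

/-- The form is non-degenerate on the subspace `I`. -/
def NondegenerateOn (Q : QuadraticLieSuperalgebra V) (I : Submodule ℂ V) : Prop :=
  ∀ X ∈ I, (∀ Y ∈ I, Q.form X Y = 0) → X = 0

/-- The form restricts to a symplectic form on the subspace `I`. -/
def SymplecticOn (Q : QuadraticLieSuperalgebra V) (I : Submodule ℂ V) : Prop :=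
  (∀ X ∈ I, Q.form X X = 0) ∧ Q.NondegenerateOn I

/-- `𝔤` is the orthogonal direct sum of the graded ideals `I` and `J`. -/
structure IsOrthogonalSum (Q : QuadraticLieSuperalgebra V) (I J : Submodule ℂ V) : Prop where
  left_ideal : Q.IsGradedIdeal I
  right_ideal : Q.IsGradedIdeal J
  isCompl : IsCompl I J
  orthogonal : ∀ X ∈ I, ∀ Y ∈ J, Q.form X Y = 0

/-- `𝔤` has a non-degenerate graded ideal other than `0` and `𝔤`. -/
def IsDecomposable (Q : QuadraticLieSuperalgebra V) : Prop :=
  ∃ I : Submodule ℂ V, Q.IsGradedIdeal I ∧ Q.NondegenerateOn I ∧ I ≠ ⊥ ∧ I ≠ ⊤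

/-- `𝔤` is non-zero and has no non-degenerate graded ideal other than `0` and `𝔤`. -/
def IsIndecomposable (Q : QuadraticLieSuperalgebra V) : Prop :=
  Nontrivial V ∧ ¬ Q.IsDecomposable

/-- Isometric isomorphism (i-isomorphism): an even linear bijection that preserves the bracket and
the form. -/
def IIso (Q : QuadraticLieSuperalgebra V) (Q' : QuadraticLieSuperalgebra W) : Prop :=
  ∃ A : V ≃ₗ[ℂ] W,
    (∀ (x : ZMod 2) (X : V), X ∈ Q.part x ↔ A X ∈ Q'.part x) ∧
    (∀ X Y : V, A (Q.bracket X Y) = Q'.bracket (A X) (A Y)) ∧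
    (∀ X Y : V, Q'.form (A X) (A Y) = Q.form X Y)

theorem bracket_even_mem (Q : QuadraticLieSuperalgebra V) (X Y : Q.part 0) :
    Q.bracket X Y ∈ Q.part 0 := by
  simpa using Q.bracket_mem 0 0 X X.2 Y Y.2

/-- The even part of a quadratic Lie superalgebra, with the restricted bracket and form. It is a
quadratic Lie algebra, that is, its own odd part is zero. -/
def evenPart (Q : QuadraticLieSuperalgebra V) : QuadraticLieSuperalgebra (Q.part 0) where
  part x := if x = 0 then ⊤ else ⊥
  isCompl := by simpa using isCompl_top_bot
  bracket := LinearMap.mk₂ ℂ (fun X Y => ⟨Q.bracket X Y, Q.bracket_even_mem X Y⟩)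
    (by intros; ext; simp) (by intros; ext; simp) (by intros; ext; simp) (by intros; ext; simp)
  bracket_mem := by
    intro x y X hX Y hY
    by_cases hx : x = 0
    · by_cases hy : y = 0
      · simp [hx, hy]
      · obtain rfl : Y = 0 := by simpa [hy] using hY
        rw [map_zero]; exact zero_mem _
    · obtain rfl : X = 0 := by simpa [hx] using hX
      rw [map_zero, LinearMap.zero_apply]; exact zero_mem _
  skew := by
    intro x y X hX Y hY
    by_cases hx : x = 0
    · by_cases hy : y = 0
      · subst hx hy
        ext
        simpa using Q.skew 0 0 X X.2 Y Y.2
      · obtain rfl : Y = 0 := by simpa [hy] using hY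
        simp
    · obtain rfl : X = 0 := by simpa [hx] using hX
      simp
  jacobi := by
    intro x y z X hX Y hY Z hZ
    by_cases hx : x = 0
    · by_cases hy : y = 0
      · by_cases hz : z = 0
        · subst hx hy hz
          ext
          simpa using Q.jacobi 0 0 0 X X.2 Y Y.2 Z Z.2
        · obtain rfl : Z = 0 := by simpa [hz] using hZ
          simp
      · obtain rfl : Y = 0 := by simpa [hy] using hY
        simp
    · obtain rfl : X = 0 := by simpa [hx] using hX
      simp
  form := (Q.form.domRestrict (Q.part 0)).compl₂ (Q.part 0).subtype
  supersymm := by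
    intro x y X hX Y hY
    by_cases hx : x = 0
    · by_cases hy : y = 0
      · subst hx hy
        simpa using Q.supersymm 0 0 X X.2 Y Y.2
      · obtain rfl : Y = 0 := by simpa [hy] using hY
        simp
    · obtain rfl : X = 0 := by simpa [hx] using hX
      simp
  invariant := by
    intro X Y Z
    simpa using Q.invariant X Y Z
  nondegenerate := by
    intro X h
    ext
    refine Q.nondegenerate X fun Y => ?_
    have hY : Y ∈ Q.part 0 ⊔ Q.part 1 := by simp [Q.isCompl.sup_eq_top]
    obtain ⟨Y₀, h₀, Y₁, h₁, rfl⟩ := Submodule.mem_sup.1 hY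
    have := h ⟨Y₀, h₀⟩
    simp only [LinearMap.compl₂_apply, LinearMap.domRestrict_apply, Submodule.subtype_apply] at this
    rw [map_add, this, Q.even X X.2 Y₁ h₁, add_zero]
  even := by
    intro X _ Y hY
    obtain rfl : Y = 0 := by simpa using hY
    simp

end QuadraticLieSuperalgebra

/-! The six-dimensional quadratic Lie algebras, on the basis `X₁, X₂, X₃, Z₁, Z₂, Z₃`. -/

namespace Quadratic

/-- Names of the basis vectors of the even part. -/
inductive EvenIdx | X1 | X2 | X3 | Z1 | Z2 | Z3
  deriving DecidableEq

open EvenIdx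

instance : Fintype EvenIdx where
  elems := {X1, X2, X3, Z1, Z2, Z3}
  complete := by intro i; cases i <;> simp

theorem sum_evenIdx {M : Type*} [AddCommMonoid M] (f : EvenIdx → M) :
    ∑ i, f i = f X1 + (f X2 + (f X3 + (f Z1 + (f Z2 + f Z3)))) := by
  change ∑ i ∈ ({X1, X2, X3, Z1, Z2, Z3} : Finset EvenIdx), f i = _
  simp

/-- The underlying space of the six-dimensional algebras, as coordinate vectors. -/
abbrev V6 : Type := EvenIdx → ℂ

/-- The underlying space of the eight-dimensional superalgebras: an even vector, and the
coordinates of an odd vector with respect to `Y, T`. -/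
abbrev V8 : Type := V6 × (Fin 2 → ℂ)

/-- The basis vector with the given name. -/
noncomputable def e (i : EvenIdx) : V6 := Pi.single i 1

theorem e_apply (i j : EvenIdx) : e i j = if j = i then 1 else 0 := by
  simp [e, Pi.single_apply]

/-- The skew-symmetric bilinear bracket on `V6` with `[e i, e j] = t i j - t j i`. Thus a list `t` of
brackets that mentions each pair in at most one order is completed by skew-symmetry. -/
noncomputable def evenBracket (t : EvenIdx → EvenIdx → V6) : V6 →ₗ[ℂ] V6 →ₗ[ℂ] V6 :=
  LinearMap.mk₂ ℂ (fun u v => ∑ i, ∑ j, (u i * v j - v i * u j) • t i j)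
    (by intro u u' v; simp only [← Finset.sum_add_distrib, ← add_smul, Pi.add_apply]
        refine Finset.sum_congr rfl fun i _ => Finset.sum_congr rfl fun j _ => ?_
        congr 1; ring)
    (by intro c u v; simp only [Finset.smul_sum, smul_smul, Pi.smul_apply, smul_eq_mul]
        refine Finset.sum_congr rfl fun i _ => Finset.sum_congr rfl fun j _ => ?_
        congr 1; ring)
    (by intro u v v'; simp only [← Finset.sum_add_distrib, ← add_smul, Pi.add_apply]
        refine Finset.sum_congr rfl fun i _ => Finset.sum_congr rfl fun j _ => ?_
        congr 1; ring)
    (by intro c u v; simp only [Finset.smul_sum, smul_smul, Pi.smul_apply, smul_eq_mul]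
        refine Finset.sum_congr rfl fun i _ => Finset.sum_congr rfl fun j _ => ?_
        congr 1; ring)

theorem evenBracket_apply (t : EvenIdx → EvenIdx → V6) (u v : V6) :
    evenBracket t u v = ∑ i, ∑ j, (u i * v j - v i * u j) • t i j := rfl

/-- The symmetric form on `V6` with `B(Xᵢ, Zⱼ) = δᵢⱼ` and `B(Xᵢ, Xⱼ) = B(Zᵢ, Zⱼ) = 0`. -/
noncomputable def evenForm : V6 →ₗ[ℂ] V6 →ₗ[ℂ] ℂ :=
  LinearMap.mk₂ ℂ (fun u v => u X1 * v Z1 + u X2 * v Z2 + u X3 * v Z3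
      + u Z1 * v X1 + u Z2 * v X2 + u Z3 * v X3)
    (by intros; simp; ring) (by intros; simp; ring) (by intros; simp; ring) (by intros; simp; ring)

theorem evenForm_apply (u v : V6) : evenForm u v = u X1 * v Z1 + u X2 * v Z2 + u X3 * v Z3
      + u Z1 * v X1 + u Z2 * v X2 + u Z3 * v X3 := rfl

theorem evenForm_comm (u v : V6) : evenForm u v = evenForm v u := by
  simp only [evenForm_apply]; ring

theorem evenForm_nondegenerate (u : V6) (h : ∀ v, evenForm u v = 0) : u = 0 := by
  ext i
  cases i
  · simpa [evenForm_apply, e_apply] using h (e Z1)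
  · simpa [evenForm_apply, e_apply] using h (e Z2)
  · simpa [evenForm_apply, e_apply] using h (e Z3)
  · simpa [evenForm_apply, e_apply] using h (e X1)
  · simpa [evenForm_apply, e_apply] using h (e X2)
  · simpa [evenForm_apply, e_apply] using h (e X3)

theorem evenBracket_skew (t : EvenIdx → EvenIdx → V6) (u v : V6) :
    evenBracket t u v = -evenBracket t v u := by
  simp only [evenBracket_apply, ← Finset.sum_neg_distrib, ← neg_smul]
  refine Finset.sum_congr rfl fun i _ => Finset.sum_congr rfl fun j _ => ?_
  congr 1; ring

/-- The table `t` defines a quadratic Lie algebra on `V6`. -/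
structure EvenOK (t : EvenIdx → EvenIdx → V6) : Prop where
  jacobi : ∀ u v w, evenBracket t (evenBracket t u v) w + evenBracket t (evenBracket t v w) u
    + evenBracket t (evenBracket t w u) v = 0
  invariant : ∀ u v w, evenForm (evenBracket t u v) w = evenForm u (evenBracket t v w)

/-- The quadratic Lie algebra on `V6` with brackets listed by `t`. -/
noncomputable def even6 (t : EvenIdx → EvenIdx → V6) (ht : EvenOK t) :
    QuadraticLieSuperalgebra V6 where
  part x := if x = 0 then ⊤ else ⊥
  isCompl := by simpa using isCompl_top_bot
  bracket := evenBracket t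
  bracket_mem := by
    intro x y X hX Y hY
    by_cases hx : x = 0
    · by_cases hy : y = 0
      · simp [hx, hy]
      · obtain rfl : Y = 0 := by simpa [hy] using hY
        rw [map_zero]; exact zero_mem _
    · obtain rfl : X = 0 := by simpa [hx] using hX
      rw [map_zero, LinearMap.zero_apply]; exact zero_mem _
  skew := by
    intro x y X hX Y hY
    by_cases hx : x = 0
    · subst hx; simpa [superSign] using evenBracket_skew t X Y
    · obtain rfl : X = 0 := by simpa [hx] using hX
      simp
  jacobi := by
    intro x y z X hX Y hY Z hZ
    by_cases hx : x = 0
    · by_cases hy : y = 0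
      · subst hx hy; simpa [superSign] using ht.jacobi X Y Z
      · obtain rfl : Y = 0 := by simpa [hy] using hY
        simp
    · obtain rfl : X = 0 := by simpa [hx] using hX
      simp
  form := evenForm
  supersymm := by
    intro x y X hX Y hY
    by_cases hx : x = 0
    · subst hx; simpa [superSign] using evenForm_comm X Y
    · obtain rfl : X = 0 := by simpa [hx] using hX
      simp
  invariant := ht.invariant
  nondegenerate := evenForm_nondegenerate
  even := by
    intro X _ Y hY
    obtain rfl : Y = 0 := by simpa using hY
    simp

/-- Brackets of `𝔤_{6,1}`. -/
noncomputable def t61 : EvenIdx → EvenIdx → V6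
  | X1, X2 => e Z3
  | X2, X3 => e Z1
  | X3, X1 => e Z2
  | _, _ => 0

/-- Brackets of `𝔤_{6,2}(l)`. -/
noncomputable def t62 (l : ℂ) : EvenIdx → EvenIdx → V6
  | X3, Z1 => e Z1
  | X3, Z2 => l • e Z2
  | X3, X1 => -e X1
  | X3, X2 => -l • e X2
  | Z1, X1 => e Z3
  | Z2, X2 => l • e Z3
  | _, _ => 0

/-- Brackets of `𝔤_{6,3}`. -/
noncomputable def t63 : EvenIdx → EvenIdx → V6
  | X3, Z1 => e Z1
  | X3, Z2 => e Z1 + e Z2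
  | X3, X1 => -e X1 - e X2
  | X3, X2 => -e X2
  | Z1, X1 => e Z3
  | Z2, X1 => e Z3
  | Z2, X2 => e Z3
  | _, _ => 0

theorem t61_bracket (u v : V6) : evenBracket t61 u v = fun i => match i with
    | X1 => 0
    | X2 => 0
    | X3 => 0
    | Z1 => (u X2 * v X3 - v X2 * u X3)
    | Z2 => (u X3 * v X1 - v X3 * u X1)
    | Z3 => (u X1 * v X2 - v X1 * u X2) := by
  ext i
  simp only [evenBracket_apply, sum_evenIdx, t61]
  cases i <;> simp [e_apply] <;> ring

theorem t62_bracket (l : ℂ) (u v : V6) : evenBracket (t62 l) u v = fun i => match i with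
    | X1 => -(u X3 * v X1 - v X3 * u X1)
    | X2 => -l * (u X3 * v X2 - v X3 * u X2)
    | X3 => 0
    | Z1 => (u X3 * v Z1 - v X3 * u Z1)
    | Z2 => l * (u X3 * v Z2 - v X3 * u Z2)
    | Z3 => (u Z1 * v X1 - v Z1 * u X1) + l * (u Z2 * v X2 - v Z2 * u X2) := by
  ext i
  simp only [evenBracket_apply, sum_evenIdx, t62]
  cases i <;> simp [e_apply] <;> ring

theorem t63_bracket (u v : V6) : evenBracket t63 u v = fun i => match i with
    | X1 => -(u X3 * v X1 - v X3 * u X1)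
    | X2 => -(u X3 * v X1 - v X3 * u X1) - (u X3 * v X2 - v X3 * u X2)
    | X3 => 0
    | Z1 => (u X3 * v Z1 - v X3 * u Z1) + (u X3 * v Z2 - v X3 * u Z2)
    | Z2 => (u X3 * v Z2 - v X3 * u Z2)
    | Z3 => (u Z1 * v X1 - v Z1 * u X1) + (u Z2 * v X1 - v Z2 * u X1) + (u Z2 * v X2 - v Z2 * u X2) := by
  ext i
  simp only [evenBracket_apply, sum_evenIdx, t63]
  cases i <;> simp [e_apply] <;> ring

theorem ok61 : EvenOK t61 where
  jacobi := by
    intro u v w; ext i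
    simp only [t61_bracket]
    cases i <;> simp <;> ring
  invariant := by
    intro u v w
    simp only [t61_bracket, evenForm_apply]
    ring

theorem ok62 (l : ℂ) : EvenOK (t62 l) where
  jacobi := by
    intro u v w; ext i
    simp only [t62_bracket]
    cases i <;> simp <;> ring
  invariant := by
    intro u v w
    simp only [t62_bracket, evenForm_apply]
    ring

theorem ok63 : EvenOK t63 where
  jacobi := by
    intro u v w; ext i
    simp only [t63_bracket]
    cases i <;> simp <;> ring
  invariant := by
    intro u v w
    simp only [t63_bracket, evenForm_apply]
    ring

/-- The quadratic Lie algebra `𝔤_{6,1}`. -/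
noncomputable def g61 : QuadraticLieSuperalgebra V6 := even6 t61 ok61

/-- The quadratic Lie algebra `𝔤_{6,2}(l)` (meant for `l ≠ 0`). -/
noncomputable def g62 (l : ℂ) : QuadraticLieSuperalgebra V6 := even6 (t62 l) (ok62 l)

/-- The quadratic Lie algebra `𝔤_{6,3}`. -/
noncomputable def g63 : QuadraticLieSuperalgebra V6 := even6 t63 ok63

/-! Eight-dimensional quadratic Lie superalgebras with odd basis `Y, T`. -/

/-- The part of the multiplication table that involves odd vectors. -/
structure OddData where
  /-- the matrix of `ad (e i)` on the odd part in the basis `Y, T` (columns are images) -/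
  act : EvenIdx → Matrix (Fin 2) (Fin 2) ℂ
  /-- `[Y, Y]` -/
  yy : V6
  /-- `[Y, T] = [T, Y]` -/
  yt : V6
  /-- `[T, T]` -/
  tt : V6

/-- The action of an even vector on an odd vector, bilinearly extended from `act`. -/
noncomputable def OddData.ad (d : OddData) : V6 →ₗ[ℂ] (Fin 2 → ℂ) →ₗ[ℂ] (Fin 2 → ℂ) :=
  LinearMap.mk₂ ℂ (fun u p => ∑ i, u i • (d.act i).mulVec p)
    (by intros; simp only [Pi.add_apply, add_smul, Finset.sum_add_distrib])
    (by intros; simp only [Pi.smul_apply, smul_eq_mul, Finset.smul_sum, smul_smul])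
    (by intros; simp only [Matrix.mulVec_add, smul_add, Finset.sum_add_distrib])
    (by intro c u p; simp only [Matrix.mulVec_smul, Finset.smul_sum, smul_comm c])

theorem OddData.ad_apply (d : OddData) (u : V6) (p : Fin 2 → ℂ) :
    d.ad u p = ∑ i, u i • (d.act i).mulVec p := rfl

/-- The symmetric bracket of two odd vectors, bilinearly extended from `yy`, `yt`, `tt`. -/
noncomputable def OddData.mul (d : OddData) : (Fin 2 → ℂ) →ₗ[ℂ] (Fin 2 → ℂ) →ₗ[ℂ] V6 :=
  LinearMap.mk₂ ℂ (fun p q =>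
      (p 0 * q 0) • d.yy + (p 0 * q 1 + p 1 * q 0) • d.yt + (p 1 * q 1) • d.tt)
    (by intros; simp; module) (by intros; simp; module)
    (by intros; simp; module) (by intros; simp; module)

theorem OddData.mul_apply (d : OddData) (p q : Fin 2 → ℂ) : d.mul p q =
    (p 0 * q 0) • d.yy + (p 0 * q 1 + p 1 * q 0) • d.yt + (p 1 * q 1) • d.tt := rfl

theorem OddData.mul_comm (d : OddData) (p q : Fin 2 → ℂ) : d.mul p q = d.mul q p := by
  simp only [OddData.mul_apply]; module

/-- The symplectic form on the odd part with `B(Y, T) = 1`. -/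
noncomputable def oddForm : (Fin 2 → ℂ) →ₗ[ℂ] (Fin 2 → ℂ) →ₗ[ℂ] ℂ :=
  LinearMap.mk₂ ℂ (fun p q => p 0 * q 1 - p 1 * q 0)
    (by intros; simp; ring) (by intros; simp; ring) (by intros; simp; ring) (by intros; simp; ring)

theorem oddForm_apply (p q : Fin 2 → ℂ) : oddForm p q = p 0 * q 1 - p 1 * q 0 := rfl

theorem oddForm_skew (p q : Fin 2 → ℂ) : oddForm p q = -oddForm q p := by
  simp only [oddForm_apply]; ring

/-- The tables `t` and `d` together define a quadratic Lie superalgebra on `V8`. -/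
structure SuperOK (t : EvenIdx → EvenIdx → V6) (d : OddData) : Prop where
  rep : ∀ u v p, d.ad (evenBracket t u v) p = d.ad u (d.ad v p) - d.ad v (d.ad u p)
  equivariant : ∀ u p q, evenBracket t u (d.mul p q) = d.mul (d.ad u p) q + d.mul p (d.ad u q)
  invariant : ∀ u p q, evenForm u (d.mul p q) = oddForm (d.ad u p) q
  odd_jacobi : ∀ p q r, d.ad (d.mul p q) r + d.ad (d.mul q r) p + d.ad (d.mul r p) q = 0

/-- The bracket on `V8`: `t` on even vectors, `d.ad` between even and odd vectors, `d.mul` on odd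
vectors. -/
noncomputable def superBracket (t : EvenIdx → EvenIdx → V6) (d : OddData) : V8 →ₗ[ℂ] V8 →ₗ[ℂ] V8 :=
  LinearMap.mk₂ ℂ (fun a b =>
      (evenBracket t a.1 b.1 + d.mul a.2 b.2, d.ad a.1 b.2 - d.ad b.1 a.2))
    (by intros; ext1 <;> simp <;> abel)
    (by intros; ext1 <;> simp [smul_sub])
    (by intros; ext1 <;> simp <;> abel)
    (by intros; ext1 <;> simp [smul_sub])

theorem superBracket_apply (t : EvenIdx → EvenIdx → V6) (d : OddData) (a b : V8) :
    superBracket t d a b =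
      (evenBracket t a.1 b.1 + d.mul a.2 b.2, d.ad a.1 b.2 - d.ad b.1 a.2) := rfl

/-- The form on `V8`: the orthogonal sum of `evenForm` and `oddForm`. -/
noncomputable def superForm : V8 →ₗ[ℂ] V8 →ₗ[ℂ] ℂ :=
  LinearMap.mk₂ ℂ (fun a b => evenForm a.1 b.1 + oddForm a.2 b.2)
    (by intros; simp; ring) (by intros; simp; ring) (by intros; simp; ring) (by intros; simp; ring)

theorem superForm_apply (a b : V8) :
    superForm a b = evenForm a.1 b.1 + oddForm a.2 b.2 := rfl

/-- The grading of `V8`: the even vectors are the `(u, 0)` and the odd vectors the `(0, p)`. -/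
def part8 (x : ZMod 2) : Submodule ℂ V8 :=
  if x = 0 then Submodule.prod ⊤ ⊥ else Submodule.prod ⊥ ⊤

theorem mem_part8_zero (a : V8) : a ∈ part8 0 ↔ a.2 = 0 := by
  simp [part8, Submodule.mem_prod]

theorem mem_part8_one (a : V8) : a ∈ part8 1 ↔ a.1 = 0 := by
  simp [part8, Submodule.mem_prod]

theorem zmod2_cases (x : ZMod 2) : x = 0 ∨ x = 1 := by revert x; decide

theorem superSign_one_one : superSign 1 1 = -1 := by simp [superSign, ZMod.val_one]
theorem superSign_zero_left (x : ZMod 2) : superSign 0 x = 1 := by simp [superSign]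
theorem superSign_zero_right (x : ZMod 2) : superSign x 0 = 1 := by simp [superSign]

/-- The quadratic Lie superalgebra on `V8` with brackets listed by `t` and `d`. -/
noncomputable def super8 (t : EvenIdx → EvenIdx → V6) (ht : EvenOK t) (d : OddData)
    (h : SuperOK t d) : QuadraticLieSuperalgebra V8 where
  part := part8
  isCompl := by
    constructor
    · rw [Submodule.disjoint_def]
      intro a h0 h1
      exact Prod.ext ((mem_part8_one a).1 h1) ((mem_part8_zero a).1 h0)
    · rw [codisjoint_iff, eq_top_iff]
      intro a _
      refine Submodule.mem_sup.2 ⟨(a.1, 0), (mem_part8_zero _).2 rfl, (0, a.2),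
        (mem_part8_one _).2 rfl, by simp⟩
  bracket := superBracket t d
  bracket_mem := by
    rintro x y ⟨u, p⟩ hX ⟨v, q⟩ hY
    obtain rfl | rfl := zmod2_cases x <;> obtain rfl | rfl := zmod2_cases y <;>
    simp only [mem_part8_zero, mem_part8_one] at hX hY <;> subst hX hY
    · simp [mem_part8_zero, superBracket_apply]
    · simp [mem_part8_one, superBracket_apply]
    · simp [mem_part8_one, superBracket_apply]
    · rw [show (1 + 1 : ZMod 2) = 0 by decide]
      simp [mem_part8_zero, superBracket_apply]
  skew := by
    rintro x y ⟨u, p⟩ hX ⟨v, q⟩ hY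
    obtain rfl | rfl := zmod2_cases x <;> obtain rfl | rfl := zmod2_cases y <;>
    simp only [mem_part8_zero, mem_part8_one] at hX hY <;> subst hX hY <;>
    simp [superBracket_apply, superSign_zero_left, superSign_zero_right, superSign_one_one]
    · exact evenBracket_skew t u v
    · exact d.mul_comm p q
  jacobi := by
    rintro x y z ⟨u, p⟩ hX ⟨v, q⟩ hY ⟨w, r⟩ hZ
    obtain rfl | rfl := zmod2_cases x <;> obtain rfl | rfl := zmod2_cases y <;>
    obtain rfl | rfl := zmod2_cases z <;>
    simp only [mem_part8_zero, mem_part8_one] at hX hY hZ <;> subst hX hY hZ <;>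
    simp [superBracket_apply, superSign_zero_left, superSign_zero_right, superSign_one_one]
    · exact ht.jacobi u v w
    · rw [h.rep]; abel
    · rw [h.rep]; abel
    · rw [evenBracket_skew t, h.equivariant, d.mul_comm q]; abel
    · rw [h.rep]; abel
    · rw [evenBracket_skew t, h.equivariant, d.mul_comm r]; abel
    · rw [evenBracket_skew t, h.equivariant, d.mul_comm p]; abel
    · have := h.odd_jacobi p q r
      rw [← neg_eq_zero] at this
      rw [← this]; abel
  form := superForm
  supersymm := by
    rintro x y ⟨u, p⟩ hX ⟨v, q⟩ hY
    obtain rfl | rfl := zmod2_cases x <;> obtain rfl | rfl := zmod2_cases y <;>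
    simp only [mem_part8_zero, mem_part8_one] at hX hY <;> subst hX hY <;>
    simp [superForm_apply, superSign_zero_left, superSign_zero_right, superSign_one_one]
    · exact evenForm_comm u v
    · exact oddForm_skew p q
  invariant := by
    rintro ⟨u, p⟩ ⟨v, q⟩ ⟨w, r⟩
    have e1 := ht.invariant u v w
    have e2 := h.invariant w p q
    have e3 := h.invariant u q r
    have e4 := h.invariant v p r
    have e5 := h.invariant v r p
    have e6 := h.invariant w q p
    have e7 := oddForm_skew p (d.ad v r)
    have e8 := oddForm_skew p (d.ad w q)
    have e9 := evenForm_comm (d.mul p q) w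
    rw [d.mul_comm r p] at e5
    rw [d.mul_comm q p] at e6
    simp only [superForm_apply, superBracket_apply, map_add, map_sub, LinearMap.add_apply,
      LinearMap.sub_apply]
    linear_combination e1 + e9 + e6 + e8 - e3 + e4 - e5 - e7
  nondegenerate := by
    rintro ⟨u, p⟩ hX
    have h1 : u = 0 := evenForm_nondegenerate u fun v => by
      simpa [superForm_apply] using hX (v, 0)
    have h2 : p = 0 := by
      ext i
      fin_cases i
      · simpa [superForm_apply, oddForm_apply] using hX (0, ![0, 1])
      · simpa [superForm_apply, oddForm_apply] using hX (0, ![1, 0])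
    simp [h1, h2]
  even := by
    rintro ⟨u, p⟩ hX ⟨v, q⟩ hY
    simp only [mem_part8_zero, mem_part8_one] at hX hY
    subst hX hY
    simp [superForm_apply]

/-- Odd brackets of `𝔤ˢ_{8,2,1}(l, m, n)`. -/
noncomputable def d821 (l m n : ℂ) : OddData where
  act
    | X1 => !![l, 0; 0, -l]
    | X2 => !![m, 0; 0, -m]
    | X3 => !![n, 0; 0, -n]
    | _ => 0
  yy := 0
  yt := l • e Z1 + m • e Z2 + n • e Z3
  tt := 0

/-- Odd brackets of `𝔤ˢ_{8,2,2}(l, m)`. -/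
noncomputable def d822 (l m : ℂ) : OddData where
  act
    | X1 => !![0, l; 0, 0]
    | X2 => !![0, m; 0, 0]
    | X3 => !![0, 1; 0, 0]
    | _ => 0
  yy := 0
  yt := 0
  tt := l • e Z1 + m • e Z2 + e Z3

/-- Odd brackets of `𝔤ˢ_{8,2,3}(l)` and of `𝔤ˢ_{8,2,7}`. -/
noncomputable def dNil : OddData where
  act
    | X3 => !![0, 1; 0, 0]
    | _ => 0
  yy := 0
  yt := 0
  tt := e Z3

/-- Odd brackets of `𝔤ˢ_{8,2,4}(l, m)` and of `𝔤ˢ_{8,2,8}(m)`. -/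
noncomputable def dDiag (m : ℂ) : OddData where
  act
    | X3 => !![m, 0; 0, -m]
    | _ => 0
  yy := 0
  yt := m • e Z3
  tt := 0

/-- Odd brackets of `𝔤ˢ_{8,2,5}(l)`. -/
noncomputable def d825 : OddData where
  act
    | X3 => !![1 / 2, 0; 0, -1 / 2]
    | Z1 => !![0, 1; 0, 0]
    | _ => 0
  yy := 0
  yt := (1 / 2 : ℂ) • e Z3
  tt := e X1

/-- Odd brackets of `𝔤ˢ_{8,2,6}(1, m)`. -/
noncomputable def d826 (m : ℂ) : OddData where
  act
    | X3 => !![1 / 2, 0; 0, -1 / 2]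
    | Z1 => !![0, 1; 0, 0]
    | Z2 => !![0, m; 0, 0]
    | _ => 0
  yy := 0
  yt := (1 / 2 : ℂ) • e Z3
  tt := e X1 + m • e X2

/-- Odd brackets of `𝔤ˢ_{8,2,9}`. -/
noncomputable def d829 : OddData where
  act
    | X3 => !![1 / 2, 0; 0, -1 / 2]
    | Z2 => !![0, 1; 0, 0]
    | _ => 0
  yy := 0
  yt := (1 / 2 : ℂ) • e Z3
  tt := e X2

theorem d821_ad (l m n : ℂ) (u : V6) (p : Fin 2 → ℂ) : (d821 l m n).ad u p =
    ![(l * u X1 + m * u X2 + n * u X3) * p 0, -((l * u X1 + m * u X2 + n * u X3) * p 1)] := by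
  simp only [OddData.ad_apply, sum_evenIdx, d821]
  ext i
  fin_cases i <;> simp [Matrix.mulVec, dotProduct, Fin.sum_univ_two] <;> ring

theorem d821_mul (l m n : ℂ) (p q : Fin 2 → ℂ) : (d821 l m n).mul p q = fun i => match i with
    | X1 => 0
    | X2 => 0
    | X3 => 0
    | Z1 => l * (p 0 * q 1 + p 1 * q 0)
    | Z2 => m * (p 0 * q 1 + p 1 * q 0)
    | Z3 => n * (p 0 * q 1 + p 1 * q 0) := by
  simp only [OddData.mul_apply, d821]
  ext i
  cases i <;> simp [e_apply] <;> ring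

theorem d822_ad (l m : ℂ) (u : V6) (p : Fin 2 → ℂ) : (d822 l m).ad u p =
    ![(l * u X1 + m * u X2 + u X3) * p 1, 0] := by
  simp only [OddData.ad_apply, sum_evenIdx, d822]
  ext i
  fin_cases i <;> simp [Matrix.mulVec, dotProduct, Fin.sum_univ_two] <;> ring

theorem d822_mul (l m : ℂ) (p q : Fin 2 → ℂ) : (d822 l m).mul p q = fun i => match i with
    | X1 => 0
    | X2 => 0
    | X3 => 0
    | Z1 => l * (p 1 * q 1)
    | Z2 => m * (p 1 * q 1)
    | Z3 => (p 1 * q 1) := by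
  simp only [OddData.mul_apply, d822]
  ext i
  cases i <;> simp [e_apply] <;> ring

theorem dNil_ad (u : V6) (p : Fin 2 → ℂ) : dNil.ad u p =
    ![u X3 * p 1, 0] := by
  simp only [OddData.ad_apply, sum_evenIdx, dNil]
  ext i
  fin_cases i <;> simp [Matrix.mulVec, dotProduct, Fin.sum_univ_two] <;> ring

theorem dNil_mul (p q : Fin 2 → ℂ) : dNil.mul p q = fun i => match i with
    | X1 => 0
    | X2 => 0
    | X3 => 0
    | Z1 => 0
    | Z2 => 0
    | Z3 => (p 1 * q 1) := by
  simp only [OddData.mul_apply, dNil]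
  ext i
  cases i <;> simp [e_apply] <;> ring

theorem dDiag_ad (m : ℂ) (u : V6) (p : Fin 2 → ℂ) : (dDiag m).ad u p =
    ![m * u X3 * p 0, -(m * u X3 * p 1)] := by
  simp only [OddData.ad_apply, sum_evenIdx, dDiag]
  ext i
  fin_cases i <;> simp [Matrix.mulVec, dotProduct, Fin.sum_univ_two] <;> ring

theorem dDiag_mul (m : ℂ) (p q : Fin 2 → ℂ) : (dDiag m).mul p q = fun i => match i with
    | X1 => 0
    | X2 => 0
    | X3 => 0
    | Z1 => 0
    | Z2 => 0
    | Z3 => m * (p 0 * q 1 + p 1 * q 0) := by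
  simp only [OddData.mul_apply, dDiag]
  ext i
  cases i <;> simp [e_apply] <;> ring

theorem d825_ad (u : V6) (p : Fin 2 → ℂ) : d825.ad u p =
    ![1 / 2 * u X3 * p 0 + u Z1 * p 1, -(1 / 2 * u X3 * p 1)] := by
  simp only [OddData.ad_apply, sum_evenIdx, d825]
  ext i
  fin_cases i <;> simp [Matrix.mulVec, dotProduct, Fin.sum_univ_two] <;> ring

theorem d825_mul (p q : Fin 2 → ℂ) : d825.mul p q = fun i => match i with
    | X1 => (p 1 * q 1)
    | X2 => 0
    | X3 => 0
    | Z1 => 0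
    | Z2 => 0
    | Z3 => 1 / 2 * (p 0 * q 1 + p 1 * q 0) := by
  simp only [OddData.mul_apply, d825]
  ext i
  cases i <;> simp [e_apply] <;> ring

theorem d826_ad (m : ℂ) (u : V6) (p : Fin 2 → ℂ) : (d826 m).ad u p =
    ![1 / 2 * u X3 * p 0 + (u Z1 + m * u Z2) * p 1, -(1 / 2 * u X3 * p 1)] := by
  simp only [OddData.ad_apply, sum_evenIdx, d826]
  ext i
  fin_cases i <;> simp [Matrix.mulVec, dotProduct, Fin.sum_univ_two] <;> ring

theorem d826_mul (m : ℂ) (p q : Fin 2 → ℂ) : (d826 m).mul p q = fun i => match i with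
    | X1 => (p 1 * q 1)
    | X2 => m * (p 1 * q 1)
    | X3 => 0
    | Z1 => 0
    | Z2 => 0
    | Z3 => 1 / 2 * (p 0 * q 1 + p 1 * q 0) := by
  simp only [OddData.mul_apply, d826]
  ext i
  cases i <;> simp [e_apply] <;> ring

theorem d829_ad (u : V6) (p : Fin 2 → ℂ) : d829.ad u p =
    ![1 / 2 * u X3 * p 0 + u Z2 * p 1, -(1 / 2 * u X3 * p 1)] := by
  simp only [OddData.ad_apply, sum_evenIdx, d829]
  ext i
  fin_cases i <;> simp [Matrix.mulVec, dotProduct, Fin.sum_univ_two] <;> ring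

theorem d829_mul (p q : Fin 2 → ℂ) : d829.mul p q = fun i => match i with
    | X1 => 0
    | X2 => (p 1 * q 1)
    | X3 => 0
    | Z1 => 0
    | Z2 => 0
    | Z3 => 1 / 2 * (p 0 * q 1 + p 1 * q 0) := by
  simp only [OddData.mul_apply, d829]
  ext i
  cases i <;> simp [e_apply] <;> ring

theorem ok821 (l m n : ℂ) : SuperOK t61 (d821 l m n) where
  rep := by
    intro u v p; ext i
    simp only [t61_bracket, d821_ad]
    fin_cases i <;> simp <;> ring
  equivariant := by
    intro u p q; ext i
    simp only [t61_bracket, d821_ad, d821_mul]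
    cases i <;> simp <;> ring
  invariant := by
    intro u p q
    simp [d821_ad, d821_mul, evenForm_apply, oddForm_apply] <;> ring
  odd_jacobi := by
    intro p q r; ext i
    simp only [d821_ad, d821_mul]
    fin_cases i <;> simp <;> ring

theorem ok822 (l m : ℂ) : SuperOK t61 (d822 l m) where
  rep := by
    intro u v p; ext i
    simp only [t61_bracket, d822_ad]
    fin_cases i <;> simp <;> ring
  equivariant := by
    intro u p q; ext i
    simp only [t61_bracket, d822_ad, d822_mul]
    cases i <;> simp <;> ring
  invariant := by
    intro u p q
    simp [d822_ad, d822_mul, evenForm_apply, oddForm_apply] <;> ring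
  odd_jacobi := by
    intro p q r; ext i
    simp only [d822_ad, d822_mul]
    fin_cases i <;> simp <;> ring

theorem ok823 (l : ℂ) : SuperOK (t62 l) dNil where
  rep := by
    intro u v p; ext i
    simp only [t62_bracket, dNil_ad]
    fin_cases i <;> simp <;> ring
  equivariant := by
    intro u p q; ext i
    simp only [t62_bracket, dNil_ad, dNil_mul]
    cases i <;> simp <;> ring
  invariant := by
    intro u p q
    simp [dNil_ad, dNil_mul, evenForm_apply, oddForm_apply] <;> ring
  odd_jacobi := by
    intro p q r; ext i
    simp only [dNil_ad, dNil_mul]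
    fin_cases i <;> simp <;> ring

theorem ok824 (l m : ℂ) : SuperOK (t62 l) (dDiag m) where
  rep := by
    intro u v p; ext i
    simp only [t62_bracket, dDiag_ad]
    fin_cases i <;> simp <;> ring
  equivariant := by
    intro u p q; ext i
    simp only [t62_bracket, dDiag_ad, dDiag_mul]
    cases i <;> simp <;> ring
  invariant := by
    intro u p q
    simp [dDiag_ad, dDiag_mul, evenForm_apply, oddForm_apply] <;> ring
  odd_jacobi := by
    intro p q r; ext i
    simp only [dDiag_ad, dDiag_mul]
    fin_cases i <;> simp <;> ring

theorem ok825 (l : ℂ) : SuperOK (t62 l) d825 where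
  rep := by
    intro u v p; ext i
    simp only [t62_bracket, d825_ad]
    fin_cases i <;> simp <;> ring
  equivariant := by
    intro u p q; ext i
    simp only [t62_bracket, d825_ad, d825_mul]
    cases i <;> simp <;> ring
  invariant := by
    intro u p q
    simp [d825_ad, d825_mul, evenForm_apply, oddForm_apply] <;> ring
  odd_jacobi := by
    intro p q r; ext i
    simp only [d825_ad, d825_mul]
    fin_cases i <;> simp <;> ring

theorem ok826 (m : ℂ) : SuperOK (t62 1) (d826 m) where
  rep := by
    intro u v p; ext i
    simp only [t62_bracket, d826_ad]
    fin_cases i <;> simp <;> ring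
  equivariant := by
    intro u p q; ext i
    simp only [t62_bracket, d826_ad, d826_mul]
    cases i <;> simp <;> ring
  invariant := by
    intro u p q
    simp [d826_ad, d826_mul, evenForm_apply, oddForm_apply] <;> ring
  odd_jacobi := by
    intro p q r; ext i
    simp only [d826_ad, d826_mul]
    fin_cases i <;> simp <;> ring

theorem ok827 : SuperOK t63 dNil where
  rep := by
    intro u v p; ext i
    simp only [t63_bracket, dNil_ad]
    fin_cases i <;> simp <;> ring
  equivariant := by
    intro u p q; ext i
    simp only [t63_bracket, dNil_ad, dNil_mul]
    cases i <;> simp <;> ring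
  invariant := by
    intro u p q
    simp [dNil_ad, dNil_mul, evenForm_apply, oddForm_apply] <;> ring
  odd_jacobi := by
    intro p q r; ext i
    simp only [dNil_ad, dNil_mul]
    fin_cases i <;> simp <;> ring

theorem ok828 (l : ℂ) : SuperOK t63 (dDiag l) where
  rep := by
    intro u v p; ext i
    simp only [t63_bracket, dDiag_ad]
    fin_cases i <;> simp <;> ring
  equivariant := by
    intro u p q; ext i
    simp only [t63_bracket, dDiag_ad, dDiag_mul]
    cases i <;> simp <;> ring
  invariant := by
    intro u p q
    simp [dDiag_ad, dDiag_mul, evenForm_apply, oddForm_apply] <;> ring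
  odd_jacobi := by
    intro p q r; ext i
    simp only [dDiag_ad, dDiag_mul]
    fin_cases i <;> simp <;> ring

theorem ok829 : SuperOK t63 d829 where
  rep := by
    intro u v p; ext i
    simp only [t63_bracket, d829_ad]
    fin_cases i <;> simp <;> ring
  equivariant := by
    intro u p q; ext i
    simp only [t63_bracket, d829_ad, d829_mul]
    cases i <;> simp <;> ring
  invariant := by
    intro u p q
    simp [d829_ad, d829_mul, evenForm_apply, oddForm_apply] <;> ring
  odd_jacobi := by
    intro p q r; ext i
    simp only [d829_ad, d829_mul]
    fin_cases i <;> simp <;> ring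

/-- The quadratic Lie superalgebra `𝔤ˢ_{8,2,1}(l, m, n)` (meant for `l, m, n` not all zero). -/
noncomputable def g821 (l m n : ℂ) : QuadraticLieSuperalgebra V8 :=
  super8 t61 ok61 (d821 l m n) (ok821 l m n)

/-- The quadratic Lie superalgebra `𝔤ˢ_{8,2,2}(l, m)`. -/
noncomputable def g822 (l m : ℂ) : QuadraticLieSuperalgebra V8 :=
  super8 t61 ok61 (d822 l m) (ok822 l m)

/-- The quadratic Lie superalgebra `𝔤ˢ_{8,2,3}(l)` (meant for `l ≠ 0`). -/
noncomputable def g823 (l : ℂ) : QuadraticLieSuperalgebra V8 :=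
  super8 (t62 l) (ok62 l) dNil (ok823 l)

/-- The quadratic Lie superalgebra `𝔤ˢ_{8,2,4}(l, m)` (meant for `l ≠ 0`, `m ≠ 0`). -/
noncomputable def g824 (l m : ℂ) : QuadraticLieSuperalgebra V8 :=
  super8 (t62 l) (ok62 l) (dDiag m) (ok824 l m)

/-- The quadratic Lie superalgebra `𝔤ˢ_{8,2,5}(l)` (meant for `l ≠ 0`). -/
noncomputable def g825 (l : ℂ) : QuadraticLieSuperalgebra V8 :=
  super8 (t62 l) (ok62 l) d825 (ok825 l)

/-- The quadratic Lie superalgebra `𝔤ˢ_{8,2,6}(1, m)` (meant for `m ≠ 0`). -/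
noncomputable def g826 (m : ℂ) : QuadraticLieSuperalgebra V8 :=
  super8 (t62 1) (ok62 1) (d826 m) (ok826 m)

/-- The quadratic Lie superalgebra `𝔤ˢ_{8,2,7}`. -/
noncomputable def g827 : QuadraticLieSuperalgebra V8 :=
  super8 t63 ok63 dNil ok827

/-- The quadratic Lie superalgebra `𝔤ˢ_{8,2,8}(l)` (meant for `l ≠ 0`). -/
noncomputable def g828 (l : ℂ) : QuadraticLieSuperalgebra V8 :=
  super8 t63 ok63 (dDiag l) (ok828 l)

/-- The quadratic Lie superalgebra `𝔤ˢ_{8,2,9}`. -/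
noncomputable def g829 : QuadraticLieSuperalgebra V8 :=
  super8 t63 ok63 d829 ok829

end Quadratic

/-!
The proof separates the even part from its action on the odd part.

*Even part.* Solvability makes the even part a quadratic Lie algebra that is not perfect, so its
centre, the orthogonal of the derived algebra, is non-zero; indecomposability makes the centre
totally isotropic (`IsEven.form_central`). The bracket is encoded by the alternating trilinear form
`B([x, y], z)`, whose radical is the centre. If the centre contains two independent vectors, this is
a trilinear form in four variables, hence it has one more radical vector, and the algebra is
`𝔤_{6,1}` (`IsEven.hasTable_t61`). If the centre is a line spanned by `z`, the form on the
four-dimensional space `z⊥ / z` also has a radical vector; the Jacobi identity makes this vector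
central, so it vanishes, and the algebra is the double extension of an abelian algebra by a skew
operator `ad x` (`IsEven.isDoubleExtension`). The operator is invertible, and completing one of its
eigenvectors to a Witt basis gives `𝔤_{6,2}` or `𝔤_{6,3}`
(`IsDoubleExtension.hasTable_t62_or_t63`).

*Odd part.* By Lie's theorem the even part acts on the odd symplectic plane by triangular matrices
in a basis `Y, T`. By invariance the action is `[u, Y] = B(u, a) Y`,
`[u, T] = -B(u, a) T + B(u, b) Y` with `a = [Y, T]` and `b = [T, T]`, so the superalgebra is
determined by the even part and the two vectors `a, b` (`IsTriangular.iIso`). The identities of the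
superalgebra say that `a` is central, that `a, b` span a totally isotropic subspace and that
`[v, b] = 2 B(v, b) a - 2 B(v, a) b`. If `a = 0`, then `b` is central. If `a ≠ 0`, then replacing
`T` by `T + d Y` either removes `b` or, in the case of a double extension, makes it an eigenvector
of `ad x`, which can serve as the initial eigenvector in the normal form of the even part. As this
eigenvector may be prescribed, the family `𝔤ˢ_{8,2,6}` is covered by `𝔤ˢ_{8,2,5}`.

*Decomposability.* A non-degenerate graded ideal meets the even part trivially or contains it, and
likewise for the odd plane, so a proper one forces the action on the odd part to be zero
(`IsDecomposable.trivial`). Conversely, if `a = b = 0`, the even part is a direct factor.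
-/

/-! ### Quadratic Lie algebras -/

namespace QuadraticLieSuperalgebra

open Quadratic EvenIdx

variable {L : Type*} [AddCommGroup L] [Module ℂ L]

/-- A quadratic Lie algebra, encoded as a quadratic Lie superalgebra all of whose vectors are
even. -/
def IsEven (Q : QuadraticLieSuperalgebra L) : Prop := Q.part 0 = ⊤

/-- Central vectors. -/
def IsCentral (Q : QuadraticLieSuperalgebra L) (z : L) : Prop := ∀ x, Q.bracket x z = 0

theorem evenPart_isEven (Q : QuadraticLieSuperalgebra L) : Q.evenPart.IsEven := by
  simp [IsEven, evenPart]

namespace IsCentral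

variable {Q : QuadraticLieSuperalgebra L} {z w : L}

theorem smul (hz : Q.IsCentral z) (c : ℂ) : Q.IsCentral (c • z) := fun x => by
  rw [map_smul, hz x, smul_zero]

theorem add (hz : Q.IsCentral z) (hw : Q.IsCentral w) : Q.IsCentral (z + w) := fun x => by
  rw [map_add, hz x, hw x, add_zero]

theorem sub (hz : Q.IsCentral z) (hw : Q.IsCentral w) : Q.IsCentral (z - w) := fun x => by
  rw [map_sub, hz x, hw x, sub_zero]

theorem tri_eq_zero (hz : Q.IsCentral z) (x y : L) : Q.form (Q.bracket x y) z = 0 := by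
  rw [Q.invariant, hz, map_zero]

end IsCentral

namespace IsEven

variable {Q : QuadraticLieSuperalgebra L} (h : Q.IsEven)
include h

theorem skew (x y : L) : Q.bracket x y = -Q.bracket y x := by
  simpa [superSign] using Q.skew 0 0 x (h ▸ Submodule.mem_top) y (h ▸ Submodule.mem_top)

theorem form_comm (x y : L) : Q.form x y = Q.form y x := by
  simpa [superSign] using Q.supersymm 0 0 x (h ▸ Submodule.mem_top) y (h ▸ Submodule.mem_top)

theorem jacobi (x y z : L) : Q.bracket (Q.bracket x y) z + Q.bracket (Q.bracket y z) x
    + Q.bracket (Q.bracket z x) y = 0 := by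
  simpa [superSign] using Q.jacobi 0 0 0 x (h ▸ Submodule.mem_top) y (h ▸ Submodule.mem_top)
    z (h ▸ Submodule.mem_top)

theorem bracket_self (x : L) : Q.bracket x x = 0 := by
  have := h.skew x x
  rwa [eq_neg_iff_add_eq_zero, ← two_smul ℂ, smul_eq_zero_iff_right two_ne_zero] at this

/-- The trilinear form `B([x, y], z)` is alternating: first transposition. -/
theorem tri_swap_left (x y z : L) : Q.form (Q.bracket x y) z = -Q.form (Q.bracket y x) z := by
  rw [h.skew x y, map_neg, LinearMap.neg_apply]

/-- The trilinear form `B([x, y], z)` is alternating: second transposition. -/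
theorem tri_swap_right (x y z : L) : Q.form (Q.bracket x y) z = -Q.form (Q.bracket x z) y := by
  rw [Q.invariant, Q.invariant, h.skew y z, map_neg]

theorem central_bracket {z : L} (hz : Q.IsCentral z) (x : L) : Q.bracket z x = 0 := by
  rw [h.skew, hz x, neg_zero]

/-- The centre of an indecomposable quadratic Lie algebra of dimension at least two is totally
isotropic: a non-isotropic central line would be a direct factor. -/
theorem form_central (hind : Q.IsIndecomposable) (hdim : 1 < Module.finrank ℂ L) {z w : L}
    (hz : Q.IsCentral z) (hw : Q.IsCentral w) : Q.form z w = 0 := by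
  have key : ∀ z, Q.IsCentral z → Q.form z z = 0 := by
    intro z hz
    by_contra hne
    refine hind.2 ⟨Submodule.span ℂ {z}, ⟨?_, ?_⟩, ?_, ?_, ?_⟩
    · intro X₀ _ X₁ h1 hX
      have : X₁ = 0 := by
        have := Q.isCompl.disjoint
        rw [show Q.part 0 = ⊤ from h, top_disjoint] at this
        simpa [this] using h1
      subst this
      simpa using hX
    · intro X Y hY
      obtain ⟨c, rfl⟩ := Submodule.mem_span_singleton.1 hY
      rw [hz.smul c X]; exact zero_mem _
    · intro X hX hX0
      obtain ⟨c, rfl⟩ := Submodule.mem_span_singleton.1 hX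
      have := hX0 z (Submodule.mem_span_singleton_self z)
      rw [map_smul, LinearMap.smul_apply, smul_eq_mul, mul_eq_zero] at this
      rw [this.resolve_right hne, zero_smul]
    · intro hbot
      apply hne
      rw [Submodule.span_singleton_eq_bot.1 hbot, map_zero]
    · intro htop
      have := finrank_span_le_card (R := ℂ) {z}
      rw [htop, finrank_top] at this
      simp only [Set.toFinset_singleton, Finset.card_singleton] at this
      omega
  have h1 := key _ (hz.add hw)
  simp only [map_add, LinearMap.add_apply, key z hz, key w hw, h.form_comm w z] at h1
  linear_combination h1 / 2

/-- A quadratic Lie algebra that is not perfect has a non-zero centre, the orthogonal of the derived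
algebra. -/
theorem exists_central [FiniteDimensional ℂ L]
    (hperf : Submodule.map₂ Q.bracket ⊤ ⊤ ≠ ⊤) : ∃ z, z ≠ 0 ∧ Q.IsCentral z := by
  obtain ⟨φ, hφ, hle⟩ := Submodule.exists_le_ker_of_lt_top _ (lt_top_iff_ne_top.2 hperf)
  have hinj : Function.Injective Q.form := by
    rw [← LinearMap.ker_eq_bot, LinearMap.ker_eq_bot']
    intro x hx
    exact Q.nondegenerate x fun y => by rw [hx, LinearMap.zero_apply]
  obtain ⟨z, rfl⟩ := (LinearMap.injective_iff_surjective_of_finrank_eq_finrank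
    (Subspace.dual_finrank_eq (K := ℂ) (V := L)).symm).1 hinj φ
  refine ⟨z, ?_, fun x => Q.nondegenerate _ fun y => ?_⟩
  · rintro rfl; exact hφ (map_zero _)
  · have h1 : Q.bracket x y ∈ Submodule.map₂ Q.bracket ⊤ ⊤ :=
      Submodule.apply_mem_map₂ _ Submodule.mem_top Submodule.mem_top
    have h2 : Q.form z (Q.bracket x y) = 0 := hle h1
    rw [h.skew, map_neg, LinearMap.neg_apply, Q.invariant, h2, neg_zero]

end IsEven

/-! ### Hyperbolic planes and Witt bases -/

theorem nondegenerateOn_top (Q : QuadraticLieSuperalgebra L) : Q.NondegenerateOn ⊤ :=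
  fun X _ hX => Q.nondegenerate X fun Y => hX Y Submodule.mem_top

/-- The vectors of `S` orthogonal to `x` and `z`. -/
def hypCompl (Q : QuadraticLieSuperalgebra L) (S : Submodule ℂ L) (x z : L) : Submodule ℂ L :=
  S ⊓ (LinearMap.ker (Q.form x) ⊓ LinearMap.ker (Q.form z))

theorem mem_hypCompl {Q : QuadraticLieSuperalgebra L} {S : Submodule ℂ L} {x z v : L} :
    v ∈ Q.hypCompl S x z ↔ v ∈ S ∧ Q.form x v = 0 ∧ Q.form z v = 0 := by
  simp [hypCompl, Submodule.mem_inf]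

theorem finrank_le_hypCompl [FiniteDimensional ℂ L] (Q : QuadraticLieSuperalgebra L)
    (S : Submodule ℂ L) (x z : L) :
    Module.finrank ℂ S ≤ Module.finrank ℂ (Q.hypCompl S x z) + 2 := by
  let g : S →ₗ[ℂ] ℂ × ℂ := ((Q.form x).prod (Q.form z)).comp S.subtype
  have h1 := LinearMap.finrank_range_add_finrank_ker g
  have h2 : Module.finrank ℂ (LinearMap.range g) ≤ 2 := by
    simpa using Submodule.finrank_le (LinearMap.range g)
  have h3 : Module.finrank ℂ (LinearMap.ker g) ≤ Module.finrank ℂ (Q.hypCompl S x z) := by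
    rw [← Submodule.finrank_map_subtype_eq S (LinearMap.ker g)]
    apply Submodule.finrank_mono
    rintro _ ⟨v, hv, rfl⟩
    have hv' : (Q.form x v, Q.form z v) = 0 := hv
    exact mem_hypCompl.2 ⟨v.2, Prod.mk_eq_zero.1 hv'⟩
  omega

namespace IsEven

variable {Q : QuadraticLieSuperalgebra L} (h : Q.IsEven)
include h

theorem exists_hyperbolic {S : Submodule ℂ L} (hS : Q.NondegenerateOn S) {z : L} (hz : z ∈ S)
    (hz0 : z ≠ 0) (hzz : Q.form z z = 0) :
    ∃ x ∈ S, Q.form x x = 0 ∧ Q.form x z = 1 := by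
  obtain ⟨y, hy, hzy⟩ : ∃ y ∈ S, Q.form z y ≠ 0 := by
    by_contra! hc
    exact hz0 (hS z hz hc)
  have hyz := h.form_comm z y
  refine ⟨(Q.form z y)⁻¹ • y - (Q.form y y / (2 * Q.form z y ^ 2)) • z,
    S.sub_mem (S.smul_mem _ hy) (S.smul_mem _ hz), ?_, ?_⟩
  · simp only [map_sub, map_smul, LinearMap.sub_apply, LinearMap.smul_apply, smul_eq_mul, hzz,
      ← hyz]
    field_simp
    ring
  · simp only [map_sub, map_smul, LinearMap.sub_apply, LinearMap.smul_apply, smul_eq_mul, hzz,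
      ← hyz]
    field_simp
    ring

theorem nondegenerateOn_hypCompl {S : Submodule ℂ L} (hS : Q.NondegenerateOn S) {x z : L}
    (hx : x ∈ S) (hz : z ∈ S) (hxx : Q.form x x = 0) (hzz : Q.form z z = 0)
    (hxz : Q.form x z = 1) : Q.NondegenerateOn (Q.hypCompl S x z) := by
  intro v hv hv0
  obtain ⟨hvS, hxv, hzv⟩ := mem_hypCompl.1 hv
  refine hS v hvS fun w hw => ?_
  have hzx : Q.form z x = 1 := by rw [h.form_comm, hxz]
  have := hv0 (w - Q.form z w • x - Q.form x w • z) (mem_hypCompl.2 ⟨S.sub_mem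
    (S.sub_mem hw (S.smul_mem _ hx)) (S.smul_mem _ hz), by simp [hxx, hxz], by simp [hzz, hzx]⟩)
  simpa [h.form_comm v x, h.form_comm v z, hxv, hzv] using this

theorem exists_isotropic [FiniteDimensional ℂ L] {S : Submodule ℂ L}
    (hS : 2 ≤ Module.finrank ℂ S) : ∃ v ∈ S, v ≠ 0 ∧ Q.form v v = 0 := by
  obtain ⟨s, hs⟩ := Module.finrank_pos_iff_exists_ne_zero.1 (show 0 < Module.finrank ℂ S by omega)
  have hlt : Submodule.span ℂ {(s : L)} < S := by
    refine lt_of_le_of_ne ((Submodule.span_singleton_le_iff_mem _ _).2 s.2) fun he => ?_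
    have := finrank_span_le_card (R := ℂ) {(s : L)}
    rw [he] at this
    simp only [Set.toFinset_singleton, Finset.card_singleton] at this
    omega
  obtain ⟨t, htS, ht⟩ := SetLike.exists_of_lt hlt
  have hs0 : (s : L) ≠ 0 := by simpa using hs
  by_cases hss : Q.form s s = 0
  · exact ⟨s, s.2, hs0, hss⟩
  -- a root of the quadratic polynomial `B(t + c s, t + c s)` in `c`
  obtain ⟨r, hr⟩ := IsAlgClosed.exists_pow_nat_eq
    (Q.form s t ^ 2 - Q.form s s * Q.form t t) (n := 2) (by norm_num)
  refine ⟨t + ((r - Q.form s t) / Q.form s s) • (s : L), S.add_mem htS (S.smul_mem _ s.2), ?_, ?_⟩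
  · intro h0
    apply ht
    rw [eq_neg_of_add_eq_zero_left h0]
    exact neg_mem (Submodule.smul_mem _ _ (Submodule.mem_span_singleton_self _))
  · simp only [map_add, map_smul, LinearMap.add_apply, LinearMap.smul_apply, smul_eq_mul,
      h.form_comm t s]
    field_simp
    linear_combination hr

/-- A subspace of dimension at least two on which the form is non-degenerate contains a
hyperbolic pair. -/
theorem exists_hyperbolic_pair [FiniteDimensional ℂ L] {S : Submodule ℂ L}
    (hS : Q.NondegenerateOn S) (hS2 : 2 ≤ Module.finrank ℂ S) :
    ∃ x ∈ S, ∃ z ∈ S, Q.form x x = 0 ∧ Q.form z z = 0 ∧ Q.form x z = 1 := by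
  obtain ⟨z, hz, hz0, hzz⟩ := h.exists_isotropic hS2
  obtain ⟨x, hx, hxx, hxz⟩ := h.exists_hyperbolic hS hz hz0 hzz
  exact ⟨x, hx, z, hz, hxx, hzz, hxz⟩

end IsEven

/-- A family of vectors with the Gram matrix of the standard basis `X₁, X₂, X₃, Z₁, Z₂, Z₃`. -/
def IsWitt (Q : QuadraticLieSuperalgebra L) (f : EvenIdx → L) : Prop :=
  ∀ i j, Q.form (f i) (f j) = evenForm (e i) (e j)

/-- The linear map `V6 → L` that sends the standard basis to `f`. -/
noncomputable def combo (f : EvenIdx → L) : V6 →ₗ[ℂ] L := Fintype.linearCombination ℂ f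

theorem combo_apply (f : EvenIdx → L) (u : V6) : combo f u = u X1 • f X1 + (u X2 • f X2 +
    (u X3 • f X3 + (u Z1 • f Z1 + (u Z2 • f Z2 + u Z3 • f Z3)))) := by
  rw [combo, Fintype.linearCombination_apply, sum_evenIdx]

theorem combo_e (f : EvenIdx → L) (i : EvenIdx) : combo f (e i) = f i := by
  rw [combo_apply]; cases i <;> simp [e_apply]

/-- A bilinear map on `V6` is determined by its values on the standard basis. -/
theorem bilin_ext {M : Type*} [AddCommGroup M] [Module ℂ M] {F G : V6 →ₗ[ℂ] V6 →ₗ[ℂ] M}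
    (hFG : ∀ i j, F (e i) (e j) = G (e i) (e j)) : F = G := by
  refine (Pi.basisFun ℂ EvenIdx).ext fun i => (Pi.basisFun ℂ EvenIdx).ext fun j => ?_
  simpa [e] using hFG i j

/-- A linear map on `V6` is determined by its values on the standard basis. -/
theorem lin_ext {M : Type*} [AddCommGroup M] [Module ℂ M] {F G : V6 →ₗ[ℂ] M}
    (hFG : ∀ i, F (e i) = G (e i)) : F = G := by
  refine (Pi.basisFun ℂ EvenIdx).ext fun i => ?_
  simpa [e] using hFG i

namespace IsWitt

variable {Q : QuadraticLieSuperalgebra L} {f : EvenIdx → L}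

theorem form_combo (hf : Q.IsWitt f) (u v : V6) :
    Q.form (combo f u) (combo f v) = evenForm u v := by
  have : (Q.form.compl₁₂ (combo f) (combo f)) = evenForm :=
    bilin_ext fun i j => by simp [combo_e, hf i j]
  rw [← this]; rfl

theorem combo_injective (hf : Q.IsWitt f) : Function.Injective (combo f) := by
  rw [← LinearMap.ker_eq_bot, LinearMap.ker_eq_bot']
  intro u hu
  exact evenForm_nondegenerate u fun v => by rw [← hf.form_combo, hu, map_zero,
    LinearMap.zero_apply]

theorem combo_surjective [FiniteDimensional ℂ L] (hf : Q.IsWitt f)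
    (h6 : Module.finrank ℂ L = 6) : Function.Surjective (combo f) := by
  refine (LinearMap.injective_iff_surjective_of_finrank_eq_finrank ?_).1 hf.combo_injective
  rw [h6, Module.finrank_fintype_fun_eq_card]
  rfl

end IsWitt

/-- The family with the given six members. -/
def sextuple (x₁ x₂ x₃ z₁ z₂ z₃ : L) : EvenIdx → L
  | X1 => x₁
  | X2 => x₂
  | X3 => x₃
  | Z1 => z₁
  | Z2 => z₂
  | Z3 => z₃

/-- Three mutually orthogonal hyperbolic pairs form a Witt basis. -/
theorem IsEven.isWitt_sextuple {Q : QuadraticLieSuperalgebra L} (h : Q.IsEven)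
    {x₁ x₂ x₃ z₁ z₂ z₃ : L}
    (h1 : Q.form x₁ x₁ = 0 ∧ Q.form z₁ z₁ = 0 ∧ Q.form x₁ z₁ = 1)
    (h2 : Q.form x₂ x₂ = 0 ∧ Q.form z₂ z₂ = 0 ∧ Q.form x₂ z₂ = 1)
    (h3 : Q.form x₃ x₃ = 0 ∧ Q.form z₃ z₃ = 0 ∧ Q.form x₃ z₃ = 1)
    (h12 : Q.form x₁ x₂ = 0 ∧ Q.form x₁ z₂ = 0 ∧ Q.form z₁ x₂ = 0 ∧ Q.form z₁ z₂ = 0)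
    (h31 : Q.form x₃ x₁ = 0 ∧ Q.form x₃ z₁ = 0 ∧ Q.form z₃ x₁ = 0 ∧ Q.form z₃ z₁ = 0)
    (h32 : Q.form x₃ x₂ = 0 ∧ Q.form x₃ z₂ = 0 ∧ Q.form z₃ x₂ = 0 ∧ Q.form z₃ z₂ = 0) :
    Q.IsWitt (sextuple x₁ x₂ x₃ z₁ z₂ z₃) := by
  obtain ⟨a1, a2, a3⟩ := h1
  obtain ⟨b1, b2, b3⟩ := h2
  obtain ⟨c1, c2, c3⟩ := h3
  obtain ⟨p1, p2, p3, p4⟩ := h12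
  obtain ⟨q1, q2, q3, q4⟩ := h31
  obtain ⟨r1, r2, r3, r4⟩ := h32
  have a4 := h.form_comm z₁ x₁
  have b4 := h.form_comm z₂ x₂
  have c4 := h.form_comm z₃ x₃
  have p5 := h.form_comm x₂ x₁
  have p6 := h.form_comm z₂ x₁
  have p7 := h.form_comm x₂ z₁
  have p8 := h.form_comm z₂ z₁
  have q5 := h.form_comm x₁ x₃
  have q6 := h.form_comm z₁ x₃
  have q7 := h.form_comm x₁ z₃
  have q8 := h.form_comm z₁ z₃
  have r5 := h.form_comm x₂ x₃
  have r6 := h.form_comm z₂ x₃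
  have r7 := h.form_comm x₂ z₃
  have r8 := h.form_comm z₂ z₃
  intro i j
  cases i <;> cases j <;> simp [sextuple, evenForm_apply, e_apply, *]

end QuadraticLieSuperalgebra

/-! ### Structure constants in a Witt basis -/

namespace QuadraticLieSuperalgebra

open Quadratic EvenIdx

variable {L : Type*} [AddCommGroup L] [Module ℂ L]

/-- `f` is a Witt basis in which the brackets are those listed by the table `t`. The brackets are
compared through the trilinear form `B([x, y], z)`. -/
structure HasTable (Q : QuadraticLieSuperalgebra L) (f : EvenIdx → L)
    (t : EvenIdx → EvenIdx → V6) : Prop where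
  witt : Q.IsWitt f
  tri : ∀ i j k, Q.form (Q.bracket (f i) (f j)) (f k) = evenForm (evenBracket t (e i) (e j)) (e k)

/-- The table of an alternating trilinear form on `V6` with `Z₃` in its radical: the arguments are
the values at `(X₃, X₁, X₂)`, `(X₃, X₁, Z₁)`, `(X₃, X₁, Z₂)`, `(X₃, X₂, Z₁)`, `(X₃, X₂, Z₂)`,
`(X₃, Z₁, Z₂)`, `(X₁, X₂, Z₁)`, `(X₁, X₂, Z₂)`, `(X₁, Z₁, Z₂)`, `(X₂, Z₁, Z₂)`. -/
noncomputable def altTable (a₁ a₂ a₃ a₄ a₅ a₆ c₁ c₂ c₃ c₄ : ℂ) : EvenIdx → EvenIdx → V6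
  | X3, X1 => a₂ • e X1 + a₃ • e X2 + a₁ • e Z2
  | X3, X2 => a₄ • e X1 + a₅ • e X2 - a₁ • e Z1
  | X3, Z1 => a₆ • e X2 - a₂ • e Z1 - a₄ • e Z2
  | X3, Z2 => -a₆ • e X1 - a₃ • e Z1 - a₅ • e Z2
  | X1, X2 => c₁ • e X1 + c₂ • e X2 + a₁ • e Z3
  | X1, Z1 => c₃ • e X2 - c₁ • e Z2 + a₂ • e Z3
  | X1, Z2 => -c₃ • e X1 - c₂ • e Z2 + a₃ • e Z3
  | X2, Z1 => c₄ • e X2 + c₁ • e Z1 + a₄ • e Z3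
  | X2, Z2 => -c₄ • e X1 + c₂ • e Z1 + a₅ • e Z3
  | Z1, Z2 => c₃ • e Z1 + c₄ • e Z2 + a₆ • e Z3
  | _, _ => 0

theorem altTable_bracket (a₁ a₂ a₃ a₄ a₅ a₆ c₁ c₂ c₃ c₄ : ℂ) (u v : V6) :
    evenBracket (altTable a₁ a₂ a₃ a₄ a₅ a₆ c₁ c₂ c₃ c₄) u v = fun i => match i with
    | X1 => a₂ * (u X3 * v X1 - v X3 * u X1) + a₄ * (u X3 * v X2 - v X3 * u X2)
        - a₆ * (u X3 * v Z2 - v X3 * u Z2) + c₁ * (u X1 * v X2 - v X1 * u X2)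
        - c₃ * (u X1 * v Z2 - v X1 * u Z2) - c₄ * (u X2 * v Z2 - v X2 * u Z2)
    | X2 => a₃ * (u X3 * v X1 - v X3 * u X1) + a₅ * (u X3 * v X2 - v X3 * u X2)
        + a₆ * (u X3 * v Z1 - v X3 * u Z1) + c₂ * (u X1 * v X2 - v X1 * u X2)
        + c₃ * (u X1 * v Z1 - v X1 * u Z1) + c₄ * (u X2 * v Z1 - v X2 * u Z1)
    | X3 => 0
    | Z1 => -a₁ * (u X3 * v X2 - v X3 * u X2) - a₂ * (u X3 * v Z1 - v X3 * u Z1)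
        - a₃ * (u X3 * v Z2 - v X3 * u Z2) + c₁ * (u X2 * v Z1 - v X2 * u Z1)
        + c₂ * (u X2 * v Z2 - v X2 * u Z2) + c₃ * (u Z1 * v Z2 - v Z1 * u Z2)
    | Z2 => a₁ * (u X3 * v X1 - v X3 * u X1) - a₄ * (u X3 * v Z1 - v X3 * u Z1)
        - a₅ * (u X3 * v Z2 - v X3 * u Z2) - c₁ * (u X1 * v Z1 - v X1 * u Z1)
        - c₂ * (u X1 * v Z2 - v X1 * u Z2) + c₄ * (u Z1 * v Z2 - v Z1 * u Z2)
    | Z3 => a₁ * (u X1 * v X2 - v X1 * u X2) + a₂ * (u X1 * v Z1 - v X1 * u Z1)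
        + a₃ * (u X1 * v Z2 - v X1 * u Z2) + a₄ * (u X2 * v Z1 - v X2 * u Z1)
        + a₅ * (u X2 * v Z2 - v X2 * u Z2) + a₆ * (u Z1 * v Z2 - v Z1 * u Z2) := by
  ext i
  simp only [evenBracket_apply, sum_evenIdx, altTable]
  cases i <;> simp [e_apply] <;> ring

/-- An alternating function of three indices with `Z₃` in its radical vanishes once it vanishes at
the remaining ten sets of three indices. -/
theorem alternating_eq_zero {D : EvenIdx → EvenIdx → EvenIdx → ℂ}
    (hl : ∀ i j k, D i j k = -D j i k) (hr : ∀ i j k, D i j k = -D i k j)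
    (hz : ∀ i j, D i j Z3 = 0)
    (h1 : D X3 X1 X2 = 0) (h2 : D X3 X1 Z1 = 0) (h3 : D X3 X1 Z2 = 0) (h4 : D X3 X2 Z1 = 0)
    (h5 : D X3 X2 Z2 = 0) (h6 : D X3 Z1 Z2 = 0) (h7 : D X1 X2 Z1 = 0) (h8 : D X1 X2 Z2 = 0)
    (h9 : D X1 Z1 Z2 = 0) (h10 : D X2 Z1 Z2 = 0) (i j k : EvenIdx) : D i j k = 0 := by
  have d12 : ∀ i k, D i i k = 0 := fun i k => self_eq_neg.1 (hl i i k)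
  have d23 : ∀ i k, D i k k = 0 := fun i k => self_eq_neg.1 (hr i k k)
  have d13 : ∀ i k, D i k i = 0 := fun i k => by rw [hr, d12, neg_zero]
  have z2 : ∀ i j, D i Z3 j = 0 := fun i j => by rw [hr, hz, neg_zero]
  have z1 : ∀ i j, D Z3 i j = 0 := fun i j => by rw [hl, z2, neg_zero]
  have perm : ∀ {i j k}, D i j k = 0 → D j i k = 0 ∧ D i k j = 0 ∧ D k i j = 0 ∧ D j k i = 0 ∧
      D k j i = 0 := by
    intro i j k h
    have p1 : D j i k = 0 := by rw [hl, h, neg_zero]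
    have p2 : D i k j = 0 := by rw [hr, h, neg_zero]
    have p3 : D k i j = 0 := by rw [hl, p2, neg_zero]
    have p4 : D j k i = 0 := by rw [hr, p1, neg_zero]
    exact ⟨p1, p2, p3, p4, by rw [hr, p3, neg_zero]⟩
  have p1 := perm h1
  have p2 := perm h2
  have p3 := perm h3
  have p4 := perm h4
  have p5 := perm h5
  have p6 := perm h6
  have p7 := perm h7
  have p8 := perm h8
  have p9 := perm h9
  have p10 := perm h10
  clear hl hr perm
  cases i <;> cases j <;> cases k <;>
    simp only [d12, d13, d23, z1, z2, hz, h1, h2, h3, h4, h5, h6, h7, h8, h9, h10, p1, p2, p3, p4,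
      p5, p6, p7, p8, p9, p10]

/-- In a Witt basis whose last vector is central, the brackets are determined by ten structure
constants. -/
theorem IsEven.hasTable_altTable {Q : QuadraticLieSuperalgebra L} (h : Q.IsEven)
    {x₁ x₂ x₃ z₁ z₂ z₃ : L} (hf : Q.IsWitt (sextuple x₁ x₂ x₃ z₁ z₂ z₃)) (hz : Q.IsCentral z₃) :
    Q.HasTable (sextuple x₁ x₂ x₃ z₁ z₂ z₃) (altTable
      (Q.form (Q.bracket x₃ x₁) x₂) (Q.form (Q.bracket x₃ x₁) z₁) (Q.form (Q.bracket x₃ x₁) z₂)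
      (Q.form (Q.bracket x₃ x₂) z₁) (Q.form (Q.bracket x₃ x₂) z₂) (Q.form (Q.bracket x₃ z₁) z₂)
      (Q.form (Q.bracket x₁ x₂) z₁) (Q.form (Q.bracket x₁ x₂) z₂) (Q.form (Q.bracket x₁ z₁) z₂)
      (Q.form (Q.bracket x₂ z₁) z₂)) := by
  refine ⟨hf, fun i j k => sub_eq_zero.1 ?_⟩
  set f := sextuple x₁ x₂ x₃ z₁ z₂ z₃ with hf
  set t := altTable (Q.form (Q.bracket x₃ x₁) x₂) (Q.form (Q.bracket x₃ x₁) z₁)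
    (Q.form (Q.bracket x₃ x₁) z₂) (Q.form (Q.bracket x₃ x₂) z₁) (Q.form (Q.bracket x₃ x₂) z₂)
    (Q.form (Q.bracket x₃ z₁) z₂) (Q.form (Q.bracket x₁ x₂) z₁) (Q.form (Q.bracket x₁ x₂) z₂)
    (Q.form (Q.bracket x₁ z₁) z₂) (Q.form (Q.bracket x₂ z₁) z₂) with ht
  refine alternating_eq_zero (D := fun i j k => Q.form (Q.bracket (f i) (f j)) (f k) -
    evenForm (evenBracket t (e i) (e j)) (e k)) ?_ ?_ ?_ ?_ ?_ ?_ ?_ ?_ ?_ ?_ ?_ ?_ ?_ i j k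
  · intro i j k
    simp only [h.tri_swap_left (f i), evenBracket_skew t (e i), map_neg, LinearMap.neg_apply]
    ring
  · intro i j k
    have : evenForm (evenBracket t (e i) (e j)) (e k) =
        -evenForm (evenBracket t (e i) (e k)) (e j) := by
      rw [ht]
      simp only [altTable_bracket, evenForm_apply]
      ring
    simp only [h.tri_swap_right (f i) (f j), this]
    ring
  · intro i j
    simp only [hf, sextuple, hz.tri_eq_zero, ht, altTable_bracket, evenForm_apply]
    simp [e_apply]
  all_goals simp [hf, sextuple, ht, altTable_bracket, evenForm_apply, e_apply]

namespace HasTable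

variable {Q : QuadraticLieSuperalgebra L} {f : EvenIdx → L} {t t' : EvenIdx → EvenIdx → V6}

theorem congr (hf : Q.HasTable f t) (htt : ∀ u v, evenBracket t u v = evenBracket t' u v) :
    Q.HasTable f t' := ⟨hf.witt, fun i j k => by rw [hf.tri, htt]⟩

variable [FiniteDimensional ℂ L]

theorem bracket_combo (hf : Q.HasTable f t) (h6 : Module.finrank ℂ L = 6) (u v : V6) :
    Q.bracket (combo f u) (combo f v) = combo f (evenBracket t u v) := by
  have key : Q.bracket.compl₁₂ (combo f) (combo f) = (evenBracket t).compr₂ (combo f) := by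
    refine bilin_ext fun i j => sub_eq_zero.1 (Q.nondegenerate _ fun w => ?_)
    obtain ⟨w, rfl⟩ := hf.witt.combo_surjective h6 w
    have h2 : (Q.form (Q.bracket (f i) (f j) - combo f (evenBracket t (e i) (e j)))).comp
        (combo f) = 0 := lin_ext fun k => by
      rw [LinearMap.comp_apply, map_sub, LinearMap.sub_apply, hf.witt.form_combo, combo_e,
        hf.tri, sub_self, LinearMap.zero_apply]
    simpa [combo_e] using LinearMap.congr_fun h2 w
  exact LinearMap.congr_fun (LinearMap.congr_fun key u) v

/-- A quadratic Lie algebra with a Witt basis in which the brackets are listed by `t` is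
i-isomorphic to the algebra defined by `t`. -/
theorem iIso (hf : Q.HasTable f t) (h : Q.IsEven) (h6 : Module.finrank ℂ L = 6) (ht : EvenOK t) :
    Q.IIso (even6 t ht) := by
  let A := LinearEquiv.ofBijective (combo f) ⟨hf.witt.combo_injective, hf.witt.combo_surjective h6⟩
  have h1 : Q.part 1 = ⊥ := by
    have := Q.isCompl.disjoint
    rwa [show Q.part 0 = ⊤ from h, top_disjoint] at this
  refine ⟨A.symm, fun x X => ?_, fun X Y => ?_, fun X Y => ?_⟩
  · obtain rfl | rfl := zmod2_cases x
    · simp [show Q.part 0 = ⊤ from h, even6]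
    · simp [h1, even6]
  · obtain ⟨u, rfl⟩ := A.surjective X
    obtain ⟨v, rfl⟩ := A.surjective Y
    rw [LinearEquiv.symm_apply_eq, A.symm_apply_apply, A.symm_apply_apply]
    exact hf.bracket_combo h6 u v
  · obtain ⟨u, rfl⟩ := A.surjective X
    obtain ⟨v, rfl⟩ := A.surjective Y
    rw [A.symm_apply_apply, A.symm_apply_apply]
    exact (hf.witt.form_combo u v).symm

theorem isCentral_combo (hf : Q.HasTable f t) (h6 : Module.finrank ℂ L = 6) {v : V6}
    (hv : ∀ u, evenBracket t u v = 0) : Q.IsCentral (combo f v) := fun x => by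
  obtain ⟨u, rfl⟩ := hf.witt.combo_surjective h6 x
  rw [hf.bracket_combo h6, hv, map_zero]

/-- Change of Witt basis by the isometry `combo u` of `V6`. -/
theorem change (hf : Q.HasTable f t) (h6 : Module.finrank ℂ L = 6) {u : EvenIdx → V6}
    (hform : ∀ v w, evenForm (combo u v) (combo u w) = evenForm v w)
    (hbr : ∀ v w, evenBracket t (combo u v) (combo u w) = combo u (evenBracket t' v w)) :
    Q.HasTable (fun i => combo f (u i)) t' := by
  refine ⟨fun i j => ?_, fun i j k => ?_⟩
  · rw [hf.witt.form_combo, ← hform (e i), combo_e, combo_e]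
  · rw [hf.bracket_combo h6, hf.witt.form_combo, ← hform (evenBracket t' (e i) (e j)), ← hbr, combo_e,
      combo_e, combo_e]

theorem jacobi (hf : Q.HasTable f t) (h : Q.IsEven) (h6 : Module.finrank ℂ L = 6) (u v w : V6) :
    evenBracket t (evenBracket t u v) w + evenBracket t (evenBracket t v w) u
    + evenBracket t (evenBracket t w u) v = 0 := by
  apply hf.witt.combo_injective
  have := h.jacobi (combo f u) (combo f v) (combo f w)
  simpa only [hf.bracket_combo h6, ← map_add, map_zero] using this

end HasTable

/-! ### Six-dimensional indecomposable quadratic Lie algebras -/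

variable {Q : QuadraticLieSuperalgebra L}

/-- A six-dimensional indecomposable quadratic Lie algebra whose centre is not a line is
`𝔤_{6,1}`. -/
theorem IsEven.hasTable_t61 [FiniteDimensional ℂ L] (h : Q.IsEven) (hind : Q.IsIndecomposable)
    (h6 : Module.finrank ℂ L = 6) {z w : L} (hz : Q.IsCentral z) (hz0 : z ≠ 0)
    (hw : Q.IsCentral w) (hwz : ∀ c : ℂ, w ≠ c • z) : ∃ f, Q.HasTable f t61 := by
  have iso : ∀ {z w : L}, Q.IsCentral z → Q.IsCentral w → Q.form z w = 0 :=
    fun hz hw => h.form_central hind (by omega) hz hw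
  obtain ⟨x, -, hxx, hxz⟩ := h.exists_hyperbolic Q.nondegenerateOn_top Submodule.mem_top hz0
    (iso hz hz)
  have hS := h.nondegenerateOn_hypCompl Q.nondegenerateOn_top Submodule.mem_top Submodule.mem_top
    hxx (iso hz hz) hxz
  have d1 := Q.finrank_le_hypCompl ⊤ x z
  rw [finrank_top, h6] at d1
  -- the component of the second central vector orthogonal to `x`
  have hy : Q.IsCentral (w - Q.form x w • z) := hw.sub (hz.smul _)
  have hy0 : w - Q.form x w • z ≠ 0 := fun h0 => hwz _ (sub_eq_zero.1 h0)
  have hyS : w - Q.form x w • z ∈ Q.hypCompl ⊤ x z :=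
    mem_hypCompl.2 ⟨Submodule.mem_top, by simp [hxz], iso hz hy⟩
  set y := w - Q.form x w • z
  obtain ⟨x', hx'S, hxx', hxz'⟩ := h.exists_hyperbolic hS hyS hy0 (iso hy hy)
  have hS' := h.nondegenerateOn_hypCompl hS hx'S hyS hxx' (iso hy hy) hxz'
  have d2 := Q.finrank_le_hypCompl (Q.hypCompl ⊤ x z) x' y
  obtain ⟨p, hp, q, hq, hpp, hqq, hpq⟩ := h.exists_hyperbolic_pair hS' (by omega)
  have tab : ∀ p q : L, p ∈ Q.hypCompl (Q.hypCompl ⊤ x z) x' y →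
      q ∈ Q.hypCompl (Q.hypCompl ⊤ x z) x' y → Q.form p p = 0 → Q.form q q = 0 →
      Q.form p q = 1 → Q.HasTable (sextuple p x' x q y z)
        (altTable (Q.form (Q.bracket x p) x') 0 0 (Q.form (Q.bracket x x') q) 0 0 0 0 0 0) ∧
        Q.form (Q.bracket x p) x' * Q.form (Q.bracket x x') q = 0 := by
    intro p q hp hq hpp hqq hpq
    simp only [mem_hypCompl] at hp hq hx'S hyS
    have hf : Q.IsWitt (sextuple p x' x q y z) :=
      h.isWitt_sextuple ⟨hpp, hqq, hpq⟩ ⟨hxx', iso hy hy, hxz'⟩ ⟨hxx, iso hz hz, hxz⟩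
        ⟨by rw [h.form_comm, hp.2.1], by rw [h.form_comm, hp.2.2], by rw [h.form_comm, hq.2.1],
          by rw [h.form_comm, hq.2.2]⟩
        ⟨hp.1.2.1, hq.1.2.1, hp.1.2.2, hq.1.2.2⟩
        ⟨hx'S.2.1, hyS.2.1, hx'S.2.2, hyS.2.2⟩
    have ht := h.hasTable_altTable hf hz
    simp only [hy.tri_eq_zero] at ht
    set a := Q.form (Q.bracket x p) x'
    set b := Q.form (Q.bracket x p) q
    set c := Q.form (Q.bracket x x') q
    set d := Q.form (Q.bracket p x') q
    -- a trilinear alternating form in the four variables `x, p, x', q` has a radical vector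
    have hv : Q.IsCentral (combo (sextuple p x' x q y z)
        (d • e X3 - c • e X1 + b • e X2 - a • e Z1)) := by
      refine ht.isCentral_combo h6 fun u => ?_
      rw [altTable_bracket]
      ext i
      cases i <;> simp [e_apply] <;> ring
    have e1 : Q.form (combo (sextuple p x' x q y z) (d • e X3 - c • e X1 + b • e X2 - a • e Z1))
        (combo (sextuple p x' x q y z) (e Z3)) = 0 := by
      rw [combo_e _ Z3]; exact iso hv hz
    have e2 : Q.form (combo (sextuple p x' x q y z) (d • e X3 - c • e X1 + b • e X2 - a • e Z1))
        (combo (sextuple p x' x q y z) (e Z2)) = 0 := by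
      rw [combo_e _ Z2]; exact iso hv hy
    have e3 := iso hv hv
    rw [hf.form_combo] at e1 e2 e3
    have hd : d = 0 := by simpa [evenForm_apply, e_apply] using e1
    have hb : b = 0 := by simpa [evenForm_apply, e_apply] using e2
    have hac : a * c = 0 := by
      simp only [evenForm_apply] at e3
      simp [e_apply, hd, hb] at e3
      grind
    rw [hd, hb] at ht
    exact ⟨ht, hac⟩
  -- it remains to choose the two isotropic lines spanned by `p` and `q` in the right order
  have key : ∀ p q : L, p ∈ Q.hypCompl (Q.hypCompl ⊤ x z) x' y →
      q ∈ Q.hypCompl (Q.hypCompl ⊤ x z) x' y → Q.form p p = 0 → Q.form q q = 0 →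
      Q.form p q = 1 → Q.form (Q.bracket x p) x' ≠ 0 → ∃ f, Q.HasTable f t61 := by
    intro p q hp hq hpp hqq hpq ha
    set a := Q.form (Q.bracket x p) x' with hadef
    have hp' := Submodule.smul_mem _ a⁻¹ hp
    have hq' := Submodule.smul_mem _ a hq
    obtain ⟨ht, hac⟩ := tab (a⁻¹ • p) (a • q) hp' hq' (by simp [hpp]) (by simp [hqq])
      (by simp [hpq, ha])
    have h1 : Q.form (Q.bracket x (a⁻¹ • p)) x' = 1 := by
      rw [map_smul, map_smul, LinearMap.smul_apply, smul_eq_mul, ← hadef, inv_mul_cancel₀ ha]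
    rw [h1, one_mul] at hac
    rw [h1, hac] at ht
    refine ⟨_, ht.congr ?_⟩
    intro u v
    ext i
    rw [altTable_bracket, t61_bracket]
    cases i <;> simp <;> ring
  by_contra hno
  have k1 : Q.form (Q.bracket x p) x' = 0 := by
    by_contra hc; exact hno (key p q hp hq hpp hqq hpq hc)
  have k2 : Q.form (Q.bracket x q) x' = 0 := by
    by_contra hc; exact hno (key q p hq hp hqq hpp (by rw [h.form_comm, hpq]) hc)
  obtain ⟨ht, -⟩ := tab p q hp hq hpp hqq hpq
  rw [h.tri_swap_right x x', k1, k2, neg_zero] at ht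
  have hx : Q.IsCentral (combo (sextuple p x' x q y z) (e X3)) := ht.isCentral_combo h6 fun u => by
    rw [altTable_bracket]
    ext i
    cases i <;> simp
  rw [combo_e] at hx
  have := iso hx hz
  rw [show sextuple p x' x q y z X3 = x from rfl, hxz] at this
  exact one_ne_zero this

/-- The algebra is the double extension of an abelian algebra by `ad x`, with one-dimensional centre
spanned by `z`: the pair `x, z` is hyperbolic, and the bracket of two vectors orthogonal to `x` and
`z` is a multiple of `z`. -/
structure IsDoubleExtension (Q : QuadraticLieSuperalgebra L) (x z : L) : Prop where
  form_left : Q.form x x = 0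
  form_right : Q.form z z = 0
  form_pair : Q.form x z = 1
  isCentral : Q.IsCentral z
  eq_smul : ∀ w, Q.IsCentral w → ∃ c : ℂ, w = c • z
  tri : ∀ u ∈ Q.hypCompl ⊤ x z, ∀ v ∈ Q.hypCompl ⊤ x z, ∀ w ∈ Q.hypCompl ⊤ x z,
    Q.form (Q.bracket u v) w = 0

theorem IsDoubleExtension.rescale {x z : L} (hD : Q.IsDoubleExtension x z) {c : ℂ} (hc : c ≠ 0) :
    Q.IsDoubleExtension (c • x) (c⁻¹ • z) := by
  have hS : Q.hypCompl ⊤ (c • x) (c⁻¹ • z) = Q.hypCompl ⊤ x z := by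
    ext v
    simp [mem_hypCompl, hc]
  refine ⟨by simp [hD.form_left], by simp [hD.form_right], by simp [hD.form_pair, hc],
    hD.isCentral.smul _, fun w hw => ?_, by rw [hS]; exact hD.tri⟩
  obtain ⟨d, rfl⟩ := hD.eq_smul w hw
  exact ⟨d * c, by rw [smul_smul, mul_assoc, mul_inv_cancel₀ hc, mul_one]⟩

/-- If the centre is a line, spanned by `z`, then the Lie algebra `z⊥ / z` is abelian. Its bracket is
an alternating trilinear form in four variables, so it has a radical vector, and the Jacobi identity
makes this vector central. -/
theorem IsEven.isDoubleExtension [FiniteDimensional ℂ L] (h : Q.IsEven)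
    (h6 : Module.finrank ℂ L = 6) {x z : L} (hxx : Q.form x x = 0) (hzz : Q.form z z = 0)
    (hxz : Q.form x z = 1) (hz : Q.IsCentral z) (hcen : ∀ w, Q.IsCentral w → ∃ c : ℂ, w = c • z) :
    Q.IsDoubleExtension x z := by
  refine ⟨hxx, hzz, hxz, hz, hcen, ?_⟩
  have hS := h.nondegenerateOn_hypCompl Q.nondegenerateOn_top Submodule.mem_top Submodule.mem_top
    hxx hzz hxz
  have d1 := Q.finrank_le_hypCompl ⊤ x z
  rw [finrank_top, h6] at d1
  obtain ⟨p, hp, p', hp', hpp, hpp', hpair⟩ := h.exists_hyperbolic_pair hS (by omega)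
  have hS' := h.nondegenerateOn_hypCompl hS hp hp' hpp hpp' hpair
  have d2 := Q.finrank_le_hypCompl (Q.hypCompl ⊤ x z) p p'
  obtain ⟨q, hq, q', hq', hqq, hqq', hqpair⟩ := h.exists_hyperbolic_pair hS' (by omega)
  simp only [mem_hypCompl, Submodule.mem_top, true_and] at hp hp' hq hq'
  have hf : Q.IsWitt (sextuple p q x p' q' z) :=
    h.isWitt_sextuple ⟨hpp, hpp', hpair⟩ ⟨hqq, hqq', hqpair⟩ ⟨hxx, hzz, hxz⟩
      ⟨hq.2.1, hq'.2.1, hq.2.2, hq'.2.2⟩ ⟨hp.1, hp'.1, hp.2, hp'.2⟩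
      ⟨hq.1.1, hq'.1.1, hq.1.2, hq'.1.2⟩
  have ht := h.hasTable_altTable hf hz
  set f := sextuple p q x p' q' z with hfdef
  generalize Q.form (Q.bracket x p) q = a₁, Q.form (Q.bracket x p) p' = a₂,
    Q.form (Q.bracket x p) q' = a₃, Q.form (Q.bracket x q) p' = a₄,
    Q.form (Q.bracket x q) q' = a₅, Q.form (Q.bracket x p') q' = a₆,
    Q.form (Q.bracket p q) p' = c₁, Q.form (Q.bracket p q) q' = c₂,
    Q.form (Q.bracket p p') q' = c₃, Q.form (Q.bracket q p') q' = c₄ at ht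
  have e1 := congrFun (ht.jacobi h h6 (e X1) (e X2) (e Z1)) Z3
  have e2 := congrFun (ht.jacobi h h6 (e X1) (e X2) (e Z2)) Z3
  have e3 := congrFun (ht.jacobi h h6 (e X1) (e Z1) (e Z2)) Z3
  have e4 := congrFun (ht.jacobi h h6 (e X2) (e Z1) (e Z2)) Z3
  simp only [altTable_bracket, Pi.add_apply] at e1 e2 e3 e4
  simp [e_apply] at e1 e2 e3 e4
  have hv : Q.IsCentral (combo f (c₄ • e X1 - c₃ • e X2 + c₂ • e Z1 - c₁ • e Z2)) := by
    refine ht.isCentral_combo h6 fun u => ?_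
    rw [altTable_bracket]
    ext i
    cases i <;> simp [e_apply]
    · linear_combination u X3 * e4
    · linear_combination -u X3 * e3
    · linear_combination u X3 * e2
    · linear_combination -u X3 * e1
    · linear_combination -u X1 * e2 + u X2 * e1 - u Z1 * e4 + u Z2 * e3
  obtain ⟨c, hc⟩ := hcen _ hv
  have hc' : combo f (c₄ • e X1 - c₃ • e X2 + c₂ • e Z1 - c₁ • e Z2) = combo f (c • e Z3) := by
    rw [hc, map_smul, combo_e]; rfl
  have hc0 := congrFun (hf.combo_injective hc')
  have hc4 : c₄ = 0 := by simpa [e_apply] using hc0 X1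
  have hc3 : c₃ = 0 := by simpa [e_apply] using hc0 X2
  have hc2 : c₂ = 0 := by simpa [e_apply] using hc0 Z1
  have hc1 : c₁ = 0 := by simpa [e_apply] using hc0 Z2
  have coord : ∀ u ∈ Q.hypCompl ⊤ x z, ∃ u', combo f u' = u ∧ u' X3 = 0 := by
    intro u hu
    obtain ⟨u', rfl⟩ := hf.combo_surjective h6 u
    have h2 : Q.form (combo f (e Z3)) (combo f u') = 0 := by
      rw [combo_e]; exact (mem_hypCompl.1 hu).2.2
    rw [hf.form_combo] at h2
    exact ⟨u', rfl, by simpa [evenForm_apply, e_apply] using h2⟩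
  intro u hu v hv w hw
  obtain ⟨u, rfl, hu'⟩ := coord u hu
  obtain ⟨v, rfl, hv'⟩ := coord v hv
  obtain ⟨w, rfl, hw'⟩ := coord w hw
  rw [ht.bracket_combo h6, hf.form_combo, evenForm_apply, altTable_bracket]
  simp [hc1, hc2, hc3, hc4, hu', hv', hw']

/-- The dichotomy for six-dimensional indecomposable quadratic Lie algebras that are not perfect. -/
theorem IsEven.hasTable_t61_or_isDoubleExtension [FiniteDimensional ℂ L] (h : Q.IsEven)
    (hind : Q.IsIndecomposable) (h6 : Module.finrank ℂ L = 6)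
    (hperf : Submodule.map₂ Q.bracket ⊤ ⊤ ≠ ⊤) :
    (∃ f, Q.HasTable f t61) ∨ ∃ x z, Q.IsDoubleExtension x z := by
  obtain ⟨z, hz0, hz⟩ := h.exists_central hperf
  by_cases hw : ∃ w, Q.IsCentral w ∧ ∀ c : ℂ, w ≠ c • z
  · obtain ⟨w, hw, hwz⟩ := hw
    exact Or.inl (h.hasTable_t61 hind h6 hz hz0 hw hwz)
  · push Not at hw
    have hzz := h.form_central hind (by omega) hz hz
    obtain ⟨x, -, hxx, hxz⟩ := h.exists_hyperbolic Q.nondegenerateOn_top Submodule.mem_top hz0 hzz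
    exact Or.inr ⟨x, z, h.isDoubleExtension h6 hxx hzz hxz hz hw⟩

/-- The table of a double extension of an abelian algebra. -/
theorem IsDoubleExtension.hasTable (h : Q.IsEven) {x₁ x₂ x₃ z₁ z₂ z₃ : L}
    (hD : Q.IsDoubleExtension x₃ z₃) (hf : Q.IsWitt (sextuple x₁ x₂ x₃ z₁ z₂ z₃)) :
    Q.HasTable (sextuple x₁ x₂ x₃ z₁ z₂ z₃) (altTable
      (Q.form (Q.bracket x₃ x₁) x₂) (Q.form (Q.bracket x₃ x₁) z₁) (Q.form (Q.bracket x₃ x₁) z₂)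
      (Q.form (Q.bracket x₃ x₂) z₁) (Q.form (Q.bracket x₃ x₂) z₂) (Q.form (Q.bracket x₃ z₁) z₂)
      0 0 0 0) := by
  have m1 : x₁ ∈ Q.hypCompl ⊤ x₃ z₃ := mem_hypCompl.2 ⟨Submodule.mem_top,
    by simpa [sextuple, evenForm_apply, e_apply] using hf X3 X1,
    by simpa [sextuple, evenForm_apply, e_apply] using hf Z3 X1⟩
  have m2 : x₂ ∈ Q.hypCompl ⊤ x₃ z₃ := mem_hypCompl.2 ⟨Submodule.mem_top,
    by simpa [sextuple, evenForm_apply, e_apply] using hf X3 X2,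
    by simpa [sextuple, evenForm_apply, e_apply] using hf Z3 X2⟩
  have m3 : z₁ ∈ Q.hypCompl ⊤ x₃ z₃ := mem_hypCompl.2 ⟨Submodule.mem_top,
    by simpa [sextuple, evenForm_apply, e_apply] using hf X3 Z1,
    by simpa [sextuple, evenForm_apply, e_apply] using hf Z3 Z1⟩
  have m4 : z₂ ∈ Q.hypCompl ⊤ x₃ z₃ := mem_hypCompl.2 ⟨Submodule.mem_top,
    by simpa [sextuple, evenForm_apply, e_apply] using hf X3 Z2,
    by simpa [sextuple, evenForm_apply, e_apply] using hf Z3 Z2⟩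
  have ht := h.hasTable_altTable hf hD.isCentral
  rwa [hD.tri _ m1 _ m2 _ m3, hD.tri _ m1 _ m2 _ m4, hD.tri _ m1 _ m3 _ m4,
    hD.tri _ m2 _ m3 _ m4] at ht

/-- An eigenvector of `ad x` with eigenvalue `-1` extends to a Witt basis in which the matrix of
`ad x` is diagonal, or has the double eigenvalue `-1` and one off-diagonal entry `c`. -/
theorem IsDoubleExtension.exists_basis [FiniteDimensional ℂ L] (h : Q.IsEven)
    (h6 : Module.finrank ℂ L = 6) {x z p : L} (hD : Q.IsDoubleExtension x z)
    (hp : p ∈ Q.hypCompl ⊤ x z) (hp0 : p ≠ 0) (hxp : Q.bracket x p = -p) :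
    ∃ p' q q' b c, Q.HasTable (sextuple p q x p' q' z) (altTable 0 (-1) 0 c (-b) 0 0 0 0 0) ∧
      b ≠ 0 ∧ (b = 1 ∨ c = 0) := by
  have hxx := hD.form_left
  have hzz := hD.form_right
  have hxz := hD.form_pair
  have hpp : Q.form p p = 0 := by
    have h1 := h.tri_swap_right x p p
    rw [self_eq_neg, hxp] at h1
    simpa using h1
  have hS := h.nondegenerateOn_hypCompl Q.nondegenerateOn_top Submodule.mem_top Submodule.mem_top
    hxx hzz hxz
  have d1 := Q.finrank_le_hypCompl ⊤ x z
  rw [finrank_top, h6] at d1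
  obtain ⟨p', hp', hpp', hpair'⟩ := h.exists_hyperbolic hS hp hp0 hpp
  have hpair : Q.form p p' = 1 := by rw [h.form_comm, hpair']
  have hS' := h.nondegenerateOn_hypCompl hS hp hp' hpp hpp' hpair
  have d2 := Q.finrank_le_hypCompl (Q.hypCompl ⊤ x z) p p'
  obtain ⟨q₀, hq₀, q₁, hq₁, hqq₀, hqq₁, hqpair⟩ := h.exists_hyperbolic_pair hS' (by omega)
  -- exchanging the two isotropic lines changes the sign of the second eigenvalue `b`, so that
  -- `b = -1` can be avoided
  obtain ⟨q, hq, q', hq', hqq, hqq', hqpair, hb1⟩ : ∃ q ∈ Q.hypCompl (Q.hypCompl ⊤ x z) p p',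
      ∃ q' ∈ Q.hypCompl (Q.hypCompl ⊤ x z) p p', Q.form q q = 0 ∧ Q.form q' q' = 0 ∧
      Q.form q q' = 1 ∧ Q.form (Q.bracket x q) q' ≠ 1 := by
    by_cases hc : Q.form (Q.bracket x q₀) q₁ = 1
    · refine ⟨q₁, hq₁, q₀, hq₀, hqq₁, hqq₀, by rw [h.form_comm, hqpair], ?_⟩
      rw [h.tri_swap_right, hc]
      norm_num
    · exact ⟨q₀, hq₀, q₁, hq₁, hqq₀, hqq₁, hqpair, hc⟩
  clear hq₀ hq₁ hqq₀ hqq₁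
  simp only [mem_hypCompl, Submodule.mem_top, true_and] at hp hp' hq hq'
  obtain ⟨b, hb⟩ : ∃ b, Q.form (Q.bracket x q) q' = -b := ⟨_, (neg_neg _).symm⟩
  obtain ⟨c, hc⟩ : ∃ c, Q.form (Q.bracket x q) p' = c := ⟨_, rfl⟩
  obtain ⟨g, hg⟩ : ∃ g, Q.form (Q.bracket x p') q' = g := ⟨_, rfl⟩
  have hb1' : b + 1 ≠ 0 := fun h0 => hb1 (by rw [hb]; linear_combination -h0)
  -- the transvection by `r`, `s` removes the off-diagonal entries as far as possible
  obtain ⟨r, hr⟩ : ∃ r, b = 1 ∨ c + r * b - r = 0 := by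
    by_cases h1 : b = 1
    · exact ⟨0, Or.inl h1⟩
    · have : 1 - b ≠ 0 := fun h0 => h1 (by linear_combination -h0)
      exact ⟨c / (1 - b), Or.inr (by field_simp; ring)⟩
  obtain ⟨s, hs⟩ : ∃ s, g + s + s * b = 0 := ⟨-g / (b + 1), by field_simp; ring⟩
  have c1 := h.form_comm p' p
  have c2 := h.form_comm q' q
  have c3 := h.form_comm q p
  have c4 := h.form_comm q' p
  have c5 := h.form_comm q p'
  have c6 := h.form_comm q' p'
  have hf : Q.IsWitt (sextuple p (q + r • p) x (p' - s • q - r • q' - (r * s) • p)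
      (q' + s • p) z) := by
    refine h.isWitt_sextuple ⟨hpp, ?_, ?_⟩ ⟨?_, ?_, ?_⟩ ⟨hxx, hzz, hxz⟩ ⟨?_, ?_, ?_, ?_⟩
      ⟨?_, ?_, ?_, ?_⟩ ⟨?_, ?_, ?_, ?_⟩ <;> simp [*] <;> ring
  have t1 : Q.form (Q.bracket x q) q = 0 := by
    have h1 := h.tri_swap_right x q q
    rwa [self_eq_neg] at h1
  have t2 : Q.form (Q.bracket x p') p' = 0 := by
    have h1 := h.tri_swap_right x p' p'
    rwa [self_eq_neg] at h1
  have t3 : Q.form (Q.bracket x q) p = 0 := by rw [h.tri_swap_right, hxp]; simp [hq]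
  have t4 : Q.form (Q.bracket x q') p = 0 := by rw [h.tri_swap_right, hxp]; simp [hq']
  have t5 : Q.form (Q.bracket x p') p = 1 := by rw [h.tri_swap_right, hxp]; simp [hpair]
  have ht : Q.HasTable (sextuple p (q + r • p) x (p' - s • q - r • q' - (r * s) • p)
      (q' + s • p) z) (altTable 0 (-1) 0 (c + r * b - r) (-b) 0 0 0 0 0) := by
    convert hD.hasTable h hf using 2
    · simp [*]
    · simp [*]
    · simp [*]
    · simp [*]; ring
    · simp [*]
    · have t6 : Q.form (Q.bracket x q') q' = 0 := by
        have h1 := h.tri_swap_right x q' q'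
        rwa [self_eq_neg] at h1
      simp [*]
  refine ⟨_, _, _, b, c + r * b - r, ht, ?_, hr⟩
  -- a zero eigenvalue would give a second central vector
  rintro rfl
  rw [hr.resolve_left zero_ne_one] at ht
  have hcen := ht.isCentral_combo h6 (v := e X2) fun u => by
    rw [altTable_bracket]
    ext i
    cases i <;> simp [e_apply]
  obtain ⟨d, hd⟩ := hD.eq_smul _ hcen
  rw [combo_e] at hd
  have h1 := hf X2 Z2
  have h2 : Q.form z (sextuple p (q + r • p) x (p' - s • q - r • q' - (r * s) • p)
    (q' + s • p) z Z2) = _ := hf Z3 Z2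
  rw [hd, map_smul, LinearMap.smul_apply, h2] at h1
  simp [e_apply, evenForm_apply] at h1

/-- Normal form of a double extension of an abelian algebra, with a prescribed eigenvector of
`ad x`. -/
theorem IsDoubleExtension.hasTable_t62_or_t63 [FiniteDimensional ℂ L] (h : Q.IsEven)
    (h6 : Module.finrank ℂ L = 6) {x z p : L} (hD : Q.IsDoubleExtension x z)
    (hp : p ∈ Q.hypCompl ⊤ x z) (hp0 : p ≠ 0) (hxp : Q.bracket x p = -p) :
    ∃ f, f X3 = x ∧ f Z3 = z ∧ ((∃ l, l ≠ 0 ∧ Q.HasTable f (t62 l) ∧ f X1 = p) ∨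
      (Q.HasTable f t63 ∧ f X2 = p)) := by
  obtain ⟨p', q, q', b, c, ht, hb, hbc⟩ := hD.exists_basis h h6 hp hp0 hxp
  by_cases hc : c = 0
  · subst hc
    refine ⟨_, rfl, rfl, Or.inl ⟨b, hb, ht.congr fun u v => ?_, rfl⟩⟩
    rw [altTable_bracket, t62_bracket]
    ext i
    cases i <;> simp <;> ring
  obtain rfl := hbc.resolve_right hc
  -- rescale the second hyperbolic pair so that the off-diagonal entry becomes `-1`
  refine ⟨_, ?_, ?_, Or.inr ⟨ht.change h6
    (u := sextuple (-c⁻¹ • e X2) (e X1) (e X3) (-c • e Z2) (e Z1) (e Z3)) ?_ ?_, ?_⟩⟩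
  · exact combo_e _ X3
  · exact combo_e _ Z3
  · intro v w
    simp only [evenForm_apply, combo_apply]
    simp [sextuple, e_apply]
    field_simp
    ring
  · intro v w
    rw [altTable_bracket, t63_bracket]
    ext i
    simp only [combo_apply]
    cases i <;> simp [sextuple, e_apply] <;> field_simp <;> ring
  · exact combo_e _ X1

/-- The operator `ad x` of a double extension of an abelian algebra has an eigenvector, which can be
normalised to have eigenvalue `-1`. -/
theorem IsDoubleExtension.exists_eigenvector [FiniteDimensional ℂ L] (h : Q.IsEven)
    (h6 : Module.finrank ℂ L = 6) {x z : L} (hD : Q.IsDoubleExtension x z) :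
    ∃ c : ℂ, c ≠ 0 ∧ ∃ p ∈ Q.hypCompl ⊤ (c • x) (c⁻¹ • z), p ≠ 0 ∧
      Q.bracket (c • x) p = -p := by
  have hmaps : ∀ v ∈ Q.hypCompl ⊤ x z, Q.bracket x v ∈ Q.hypCompl ⊤ x z := fun v _ =>
    mem_hypCompl.2 ⟨Submodule.mem_top, by rw [← Q.invariant, h.bracket_self, map_zero,
      LinearMap.zero_apply], by rw [← Q.invariant, h.central_bracket hD.isCentral, map_zero,
      LinearMap.zero_apply]⟩
  have d1 := Q.finrank_le_hypCompl ⊤ x z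
  rw [finrank_top, h6] at d1
  have : Nontrivial (Q.hypCompl ⊤ x z) := Module.nontrivial_of_finrank_pos (R := ℂ) (by omega)
  obtain ⟨μ, hμ⟩ := Module.End.exists_eigenvalue ((Q.bracket x).restrict hmaps)
  obtain ⟨⟨p, hp⟩, hpμ, hp0⟩ := hμ.exists_hasEigenvector
  have hxp : Q.bracket x p = μ • p := congrArg Subtype.val (Module.End.mem_eigenspace_iff.1 hpμ)
  replace hp0 : p ≠ 0 := fun h0 => hp0 (Subtype.ext h0)
  have hμ0 : μ ≠ 0 := by
    rintro rfl
    rw [zero_smul] at hxp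
    have hzx : Q.form z x = 1 := by rw [h.form_comm, hD.form_pair]
    have proj : ∀ w, w - Q.form z w • x - Q.form x w • z ∈ Q.hypCompl ⊤ x z := fun w =>
      mem_hypCompl.2 ⟨Submodule.mem_top, by simp [hD.form_left, hD.form_pair],
        by simp [hD.form_right, hzx]⟩
    have hcen : Q.IsCentral p := fun w => Q.nondegenerate _ fun k => by
      have h1 := hD.tri _ (proj w) _ hp _ (proj k)
      have h2 : Q.form (Q.bracket w p) x = 0 := by
        rw [h.tri_swap_left, h.tri_swap_right, h.tri_swap_left, hxp]
        simp
      simpa [hxp, h.central_bracket hD.isCentral, hD.isCentral.tri_eq_zero, h2] using h1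
    obtain ⟨d, rfl⟩ := hD.eq_smul p hcen
    have := (mem_hypCompl.1 hp).2.1
    rw [map_smul, hD.form_pair, smul_eq_mul, mul_one] at this
    exact hp0 (by rw [this, zero_smul])
  refine ⟨-μ⁻¹, neg_ne_zero.2 (inv_ne_zero hμ0), p, ?_, hp0, ?_⟩
  · simp only [mem_hypCompl, Submodule.mem_top, true_and] at hp ⊢
    simp [hp]
  · rw [map_smul, LinearMap.smul_apply, hxp, smul_smul, neg_mul, inv_mul_cancel₀ hμ0, neg_one_smul]

/-- The normal forms `𝔤_{6,2}` and `𝔤_{6,3}` for double extensions of an abelian algebra. -/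
theorem IsDoubleExtension.exists_hasTable [FiniteDimensional ℂ L] (h : Q.IsEven)
    (h6 : Module.finrank ℂ L = 6) {x z : L} (hD : Q.IsDoubleExtension x z) :
    ∃ f, (∃ c : ℂ, c ≠ 0 ∧ z = c • f Z3) ∧
      ((∃ l, l ≠ 0 ∧ Q.HasTable f (t62 l)) ∨ Q.HasTable f t63) := by
  obtain ⟨c, hc, p, hp, hp0, hxp⟩ := hD.exists_eigenvector h h6
  obtain ⟨f, -, hz, hf⟩ := (hD.rescale hc).hasTable_t62_or_t63 h h6 hp hp0 hxp
  refine ⟨f, ⟨c, hc, by rw [hz, smul_smul, mul_inv_cancel₀ hc, one_smul]⟩, ?_⟩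
  exact hf.imp (fun ⟨l, hl, ht, _⟩ => ⟨l, hl, ht⟩) fun ⟨ht, _⟩ => ht

/-- The classification of the six-dimensional indecomposable quadratic Lie algebras that are not
perfect. -/
theorem IsEven.iIso_of_not_perfect [FiniteDimensional ℂ L] (h : Q.IsEven)
    (hind : Q.IsIndecomposable) (h6 : Module.finrank ℂ L = 6)
    (hperf : Submodule.map₂ Q.bracket ⊤ ⊤ ≠ ⊤) :
    Q.IIso g61 ∨ (∃ l : ℂ, l ≠ 0 ∧ Q.IIso (g62 l)) ∨ Q.IIso g63 := by
  obtain ⟨f, hf⟩ | ⟨x, z, hD⟩ := h.hasTable_t61_or_isDoubleExtension hind h6 hperf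
  · exact Or.inl (hf.iIso h h6 _)
  · obtain ⟨f, -, ⟨l, hl, hf⟩ | hf⟩ := hD.exists_hasTable h h6
    · exact Or.inr (Or.inl ⟨l, hl, hf.iIso h h6 _⟩)
    · exact Or.inr (Or.inr (hf.iIso h h6 _))

end QuadraticLieSuperalgebra

/-! ### The action of the even part on the odd part -/

namespace QuadraticLieSuperalgebra

open Quadratic EvenIdx

variable {V : Type*} [AddCommGroup V] [Module ℂ V] (Q : QuadraticLieSuperalgebra V)

section Homogeneous

variable {u v p q r : V}

theorem bracket_mem_even_even (hu : u ∈ Q.part 0) (hv : v ∈ Q.part 0) :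
    Q.bracket u v ∈ Q.part 0 := by
  simpa using Q.bracket_mem 0 0 u hu v hv

theorem bracket_mem_even_odd (hu : u ∈ Q.part 0) (hp : p ∈ Q.part 1) :
    Q.bracket u p ∈ Q.part 1 := by
  simpa using Q.bracket_mem 0 1 u hu p hp

theorem bracket_mem_odd_odd (hp : p ∈ Q.part 1) (hq : q ∈ Q.part 1) :
    Q.bracket p q ∈ Q.part 0 := by
  simpa [show (1 + 1 : ZMod 2) = 0 by decide] using Q.bracket_mem 1 1 p hp q hq

theorem skew_odd_even (hu : u ∈ Q.part 0) (hp : p ∈ Q.part 1) :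
    Q.bracket p u = -Q.bracket u p := by
  simpa [superSign_zero_right] using Q.skew 1 0 p hp u hu

theorem bracket_comm_odd (hp : p ∈ Q.part 1) (hq : q ∈ Q.part 1) :
    Q.bracket p q = Q.bracket q p := by
  simpa [superSign_one_one] using Q.skew 1 1 p hp q hq

theorem form_comm_even (hu : u ∈ Q.part 0) (hv : v ∈ Q.part 0) :
    Q.form u v = Q.form v u := by
  simpa [superSign_zero_left] using Q.supersymm 0 0 u hu v hv

theorem form_skew_odd (hp : p ∈ Q.part 1) (hq : q ∈ Q.part 1) :
    Q.form p q = -Q.form q p := by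
  simpa [superSign_one_one] using Q.supersymm 1 1 p hp q hq

theorem form_self_odd (hp : p ∈ Q.part 1) : Q.form p p = 0 :=
  self_eq_neg.1 (Q.form_skew_odd hp hp)

theorem form_odd_even (hu : u ∈ Q.part 0) (hp : p ∈ Q.part 1) : Q.form p u = 0 := by
  simpa [superSign_zero_right, Q.even u hu p hp] using Q.supersymm 1 0 p hp u hu

/-- The even part acts on the odd part by a representation. -/
theorem bracket_bracket_odd (hu : u ∈ Q.part 0) (hv : v ∈ Q.part 0) (hp : p ∈ Q.part 1) :
    Q.bracket (Q.bracket u v) p = Q.bracket u (Q.bracket v p) - Q.bracket v (Q.bracket u p) := by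
  have h := Q.jacobi 0 0 1 u hu v hv p hp
  simp only [superSign_zero_left, superSign_zero_right, one_smul] at h
  rw [Q.skew_odd_even hu (Q.bracket_mem_even_odd hv hp), Q.skew_odd_even hu hp, map_neg,
    LinearMap.neg_apply, Q.skew_odd_even hv (Q.bracket_mem_even_odd hu hp), neg_neg] at h
  rw [← sub_eq_zero, ← h]
  abel

theorem jacobi_odd (hp : p ∈ Q.part 1) (hq : q ∈ Q.part 1) (hr : r ∈ Q.part 1) :
    Q.bracket (Q.bracket p q) r + Q.bracket (Q.bracket q r) p + Q.bracket (Q.bracket r p) q = 0 := by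
  have h := Q.jacobi 1 1 1 p hp q hq r hr
  simp only [superSign_one_one, neg_one_smul] at h
  rw [← neg_eq_zero, ← h]
  abel

theorem eq_zero_of_even (hu : u ∈ Q.part 0) (h : ∀ v ∈ Q.part 0, Q.form u v = 0) : u = 0 := by
  refine Q.nondegenerate u fun w => ?_
  obtain ⟨w₀, h₀, w₁, h₁, rfl⟩ := Submodule.mem_sup.1 (Q.isCompl.sup_eq_top ▸ Submodule.mem_top :
    w ∈ Q.part 0 ⊔ Q.part 1)
  rw [map_add, h w₀ h₀, Q.even u hu w₁ h₁, add_zero]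

theorem eq_zero_of_odd (hp : p ∈ Q.part 1) (h : ∀ q ∈ Q.part 1, Q.form p q = 0) : p = 0 := by
  refine Q.nondegenerate p fun w => ?_
  obtain ⟨w₀, h₀, w₁, h₁, rfl⟩ := Submodule.mem_sup.1 (Q.isCompl.sup_eq_top ▸ Submodule.mem_top :
    w ∈ Q.part 0 ⊔ Q.part 1)
  rw [map_add, h w₁ h₁, Q.form_odd_even h₀ hp, add_zero]

end Homogeneous

/-- The even part of a non-trivial solvable superalgebra is not perfect. -/
theorem evenPart_not_perfect (hsolv : Q.IsSolvable) (h0 : Q.part 0 ≠ ⊥) :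
    Submodule.map₂ Q.evenPart.bracket ⊤ ⊤ ≠ ⊤ := by
  intro htop
  obtain ⟨n, hn⟩ := hsolv
  have key : ∀ n, Q.part 0 ≤ Q.derivedSeries n := by
    intro n
    induction n with
    | zero => exact le_top
    | succ n ih =>
      have h1 : Submodule.map₂ Q.evenPart.bracket ⊤ ⊤ ≤
          (Q.derivedSeries (n + 1)).comap (Q.part 0).subtype :=
        Submodule.map₂_le.2 fun x _ y _ => Submodule.apply_mem_map₂ Q.bracket (ih x.2) (ih y.2)
      intro x hx
      rw [htop] at h1
      exact h1 (Submodule.mem_top : (⟨x, hx⟩ : Q.part 0) ∈ ⊤)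
  exact h0 (le_bot_iff.1 (hn ▸ key n))

/-- The even part as a Lie ring. -/
@[reducible] noncomputable def evenLieRing : LieRing (Q.part 0) where
  bracket u v := ⟨Q.bracket u v, Q.bracket_even_mem u v⟩
  add_lie _ _ _ := Subtype.ext (by simp)
  lie_add _ _ _ := Subtype.ext (by simp)
  lie_self u := Q.evenPart_isEven.bracket_self u
  leibniz_lie u v w := by
    have h := Q.evenPart_isEven
    have h1 := h.jacobi u v w
    rw [h.skew (Q.evenPart.bracket v w) u, h.skew (Q.evenPart.bracket w u) v, h.skew w u, map_neg,
      neg_neg] at h1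
    change Q.evenPart.bracket u (Q.evenPart.bracket v w) = Q.evenPart.bracket
      (Q.evenPart.bracket u v) w + Q.evenPart.bracket v (Q.evenPart.bracket u w)
    rw [← sub_eq_zero, ← neg_eq_zero, ← h1]
    abel

/-- The even part as a Lie algebra. -/
@[reducible] noncomputable def evenLieAlgebra :
    letI := Q.evenLieRing
    LieAlgebra ℂ (Q.part 0) :=
  letI := Q.evenLieRing
  { lie_smul := fun c u v => Subtype.ext (map_smul (Q.bracket (u : V)) c (v : V)) }

/-- The odd part as a module of the Lie ring `evenLieRing`. -/
@[reducible] noncomputable def oddLieRingModule :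
    letI := Q.evenLieRing
    LieRingModule (Q.part 0) (Q.part 1) :=
  letI := Q.evenLieRing
  { bracket := fun u p => ⟨Q.bracket u p, Q.bracket_mem_even_odd u.2 p.2⟩
    add_lie := fun _ _ _ => Subtype.ext (by simp)
    lie_add := fun _ _ _ => Subtype.ext (by simp)
    leibniz_lie := fun u v p => Subtype.ext (by
      change Q.bracket u (Q.bracket v p) = Q.bracket (Q.bracket u v) p +
        Q.bracket v (Q.bracket u p)
      rw [Q.bracket_bracket_odd u.2 v.2 p.2]
      abel) }

/-- By Lie's theorem, the even part of a solvable superalgebra has a common eigenvector in the odd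
part. -/
theorem exists_odd_eigenvector [FiniteDimensional ℂ V] (hsolv : Q.IsSolvable)
    (h1 : Q.part 1 ≠ ⊥) :
    ∃ Y ∈ Q.part 1, Y ≠ 0 ∧ ∀ u ∈ Q.part 0, ∃ c : ℂ, Q.bracket u Y = c • Y := by
  let := Q.evenLieRing
  let := Q.evenLieAlgebra
  let := Q.oddLieRingModule
  have : LieModule ℂ (Q.part 0) (Q.part 1) :=
    { smul_lie := fun c u p => Subtype.ext (by
        change Q.bracket (c • (u : V)) p = c • Q.bracket u p
        rw [map_smul, LinearMap.smul_apply])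
      lie_smul := fun c u p => Subtype.ext (map_smul (Q.bracket (u : V)) c (p : V)) }
  have : LieAlgebra.IsSolvable (Q.part 0) := by
    obtain ⟨n, hn⟩ := hsolv
    have key : ∀ n, ∀ x ∈ LieAlgebra.derivedSeries ℂ (Q.part 0) n, (x : V) ∈ Q.derivedSeries n := by
      intro n
      induction n with
      | zero => exact fun x _ => Submodule.mem_top
      | succ n ih =>
        intro x hx
        rw [LieAlgebra.derivedSeries_def, LieAlgebra.derivedSeriesOfIdeal_succ,
          ← LieSubmodule.mem_toSubmodule, LieSubmodule.lieIdeal_oper_eq_linear_span'] at hx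
        have h2 : Submodule.span ℂ {m | ∃ x ∈ LieAlgebra.derivedSeriesOfIdeal ℂ (Q.part 0) n ⊤,
            ∃ y ∈ LieAlgebra.derivedSeriesOfIdeal ℂ (Q.part 0) n ⊤, ⁅x, y⁆ = m} ≤
            (Q.derivedSeries (n + 1)).comap (Q.part 0).subtype := by
          rw [Submodule.span_le]
          rintro _ ⟨x, hx, y, hy, rfl⟩
          exact Submodule.apply_mem_map₂ Q.bracket (ih x hx) (ih y hy)
        exact h2 hx
    refine LieAlgebra.IsSolvable.mk (R := ℂ) (k := n) ?_
    rw [eq_bot_iff]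
    intro x hx
    have := key n x hx
    rw [hn, Submodule.mem_bot] at this
    exact (LieSubmodule.mem_bot x).2 (Subtype.ext this)
  have : Nontrivial (Q.part 1) := Submodule.nontrivial_iff_ne_bot.2 h1
  obtain ⟨χ, hχ⟩ := LieModule.exists_nontrivial_weightSpace_of_isSolvable ℂ (Q.part 0) (Q.part 1)
  obtain ⟨⟨Y, hY⟩, hY0⟩ := exists_ne (0 : LieModule.weightSpace (Q.part 1) χ)
  rw [LieModule.mem_weightSpace] at hY
  refine ⟨Y, Y.2, fun h => hY0 (Subtype.ext (Subtype.ext h)), fun u hu => ⟨χ ⟨u, hu⟩, ?_⟩⟩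
  exact congrArg Subtype.val (hY ⟨u, hu⟩)

end QuadraticLieSuperalgebra

/-! ### Triangular bases of the odd part -/

namespace QuadraticLieSuperalgebra

open Quadratic EvenIdx

variable {V : Type*} [AddCommGroup V] [Module ℂ V] {Q : QuadraticLieSuperalgebra V}

/-- A hyperbolic pair of odd vectors spans a two-dimensional odd part. -/
theorem eq_combination_of_pair (h2 : Module.finrank ℂ (Q.part 1) = 2) {Y T : V}
    (hY : Y ∈ Q.part 1) (hT : T ∈ Q.part 1) (hYT : Q.form Y T = 1) {p : V} (hp : p ∈ Q.part 1) :
    p = Q.form p T • Y + Q.form Y p • T := by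
  have : FiniteDimensional ℂ (Q.part 1) := Module.finite_of_finrank_pos (by omega)
  let g : Q.part 1 →ₗ[ℂ] ℂ × ℂ := ((Q.form.flip T).prod (Q.form Y)).comp (Q.part 1).subtype
  have hYY := Q.form_self_odd hY
  have hTT := Q.form_self_odd hT
  have hsurj : Function.Surjective g := fun c =>
    ⟨⟨c.1 • Y + c.2 • T, add_mem (Submodule.smul_mem _ _ hY) (Submodule.smul_mem _ _ hT)⟩,
      Prod.ext (by simp [g, hYT, hTT]) (by simp [g, hYT, hYY])⟩
  have hinj : Function.Injective g :=
    (LinearMap.injective_iff_surjective_of_finrank_eq_finrank (by simp [h2])).2 hsurj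
  have : (⟨p, hp⟩ : Q.part 1) = ⟨Q.form p T • Y + Q.form Y p • T,
      add_mem (Submodule.smul_mem _ _ hY) (Submodule.smul_mem _ _ hT)⟩ :=
    hinj (Prod.ext (by simp [g, hYT, hTT]) (by simp [g, hYT, hYY]))
  exact congrArg Subtype.val this

/-- The odd vectors `Y, T` form a hyperbolic pair in which the even part acts by upper triangular
matrices. The even vectors `a = [Y, T]` and `b = [T, T]` represent the entries of the matrices. -/
structure IsTriangular (Q : QuadraticLieSuperalgebra V) (Y T : V) (a b : Q.part 0) : Prop where
  left_mem : Y ∈ Q.part 1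
  right_mem : T ∈ Q.part 1
  pair : Q.form Y T = 1
  act_left : ∀ u : Q.part 0, Q.bracket u Y = Q.evenPart.form u a • Y
  act_right : ∀ u : Q.part 0,
    Q.bracket u T = -Q.evenPart.form u a • T + Q.evenPart.form u b • Y

theorem exists_isTriangular [FiniteDimensional ℂ V] (hsolv : Q.IsSolvable)
    (h2 : Module.finrank ℂ (Q.part 1) = 2) : ∃ Y T a b, Q.IsTriangular Y T a b := by
  have h1 : Q.part 1 ≠ ⊥ := by
    intro h; rw [h, finrank_bot] at h2; omega
  obtain ⟨Y, hY, hY0, hχ⟩ := Q.exists_odd_eigenvector hsolv h1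
  obtain ⟨q, hq, hYq⟩ : ∃ q ∈ Q.part 1, Q.form Y q ≠ 0 := by
    by_contra! hc
    exact hY0 (Q.eq_zero_of_odd hY hc)
  obtain ⟨T, hT, hYT⟩ : ∃ T ∈ Q.part 1, Q.form Y T = 1 :=
    ⟨(Q.form Y q)⁻¹ • q, Submodule.smul_mem _ _ hq, by simp [hYq]⟩
  have ha : ∀ u : Q.part 0, Q.bracket u Y = Q.form u (Q.bracket Y T) • Y := by
    intro u
    obtain ⟨c, hc⟩ := hχ u u.2
    rw [← Q.invariant, hc, map_smul, LinearMap.smul_apply, hYT, smul_eq_mul, mul_one]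
  refine ⟨Y, T, ⟨Q.bracket Y T, Q.bracket_mem_odd_odd hY hT⟩,
    ⟨Q.bracket T T, Q.bracket_mem_odd_odd hT hT⟩, hY, hT, hYT, ha, fun u => ?_⟩
  change _ = -Q.form u (Q.bracket Y T) • T + Q.form u (Q.bracket T T) • Y
  have h3 := eq_combination_of_pair h2 hY hT hYT (Q.bracket_mem_even_odd u.2 hT)
  have h4 : Q.form Y (Q.bracket u T) = -Q.form u (Q.bracket Y T) := by
    rw [← Q.invariant, Q.skew_odd_even u.2 hY, ha]
    simp [hYT]
  rw [h3, h4, Q.invariant, add_comm]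

namespace IsTriangular

variable {Y T : V} {a b : Q.part 0}

/-- Change of the triangular basis. -/
theorem change (hQ : Q.IsTriangular Y T a b) {c : ℂ} (hc : c ≠ 0) (d : ℂ) :
    Q.IsTriangular (c • Y) (c⁻¹ • T + d • Y) a ((c⁻¹ ^ 2) • b + (2 * d * c⁻¹) • a) where
  left_mem := Submodule.smul_mem _ _ hQ.left_mem
  right_mem := add_mem (Submodule.smul_mem _ _ hQ.right_mem) (Submodule.smul_mem _ _ hQ.left_mem)
  pair := by simp [hQ.pair, Q.form_self_odd hQ.left_mem, hc]
  act_left u := by rw [map_smul, hQ.act_left, smul_comm]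
  act_right u := by
    simp only [map_add, map_smul, hQ.act_left, hQ.act_right, smul_eq_mul]
    match_scalars <;> field_simp
    ring

theorem form_bracket_left (hQ : Q.IsTriangular Y T a b) (u v : Q.part 0) :
    Q.evenPart.form (Q.evenPart.bracket u v) a = 0 := by
  have h1 := hQ.act_left (Q.evenPart.bracket u v)
  have h2 : Q.bracket (Q.evenPart.bracket u v : V) Y = 0 := by
    change Q.bracket (Q.bracket u v) Y = 0
    rw [Q.bracket_bracket_odd u.2 v.2 hQ.left_mem, hQ.act_left, hQ.act_left, map_smul, map_smul,
      hQ.act_left, hQ.act_left, smul_smul, smul_smul, mul_comm, sub_self]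
  have h3 := congrArg (Q.form · T) (h1.symm.trans h2)
  simpa [hQ.pair] using h3

theorem form_bracket_right (hQ : Q.IsTriangular Y T a b) (u v : Q.part 0) :
    Q.evenPart.form (Q.evenPart.bracket u v) b =
      2 * Q.evenPart.form u a * Q.evenPart.form v b
        - 2 * Q.evenPart.form v a * Q.evenPart.form u b := by
  have h1 := hQ.act_right (Q.evenPart.bracket u v)
  have h2 := Q.bracket_bracket_odd u.2 v.2 hQ.right_mem
  rw [hQ.act_right v, hQ.act_right u] at h2
  have h3 := congrArg (Q.form · T) (h1.symm.trans h2)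
  simp [hQ.act_left, hQ.act_right, hQ.pair, Q.form_self_odd hQ.right_mem] at h3
  linear_combination h3

theorem isCentral_left (hQ : Q.IsTriangular Y T a b) : Q.evenPart.IsCentral a := fun v =>
  Q.evenPart.nondegenerate _ fun u => by
    rw [Q.evenPart_isEven.form_comm, ← Q.evenPart.invariant, hQ.form_bracket_left]

theorem bracket_right (hQ : Q.IsTriangular Y T a b) (v : Q.part 0) :
    Q.evenPart.bracket v b =
      (2 * Q.evenPart.form v b) • a - (2 * Q.evenPart.form v a) • b := by
  rw [← sub_eq_zero]
  refine Q.evenPart.nondegenerate _ fun u => ?_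
  rw [Q.evenPart_isEven.form_comm, map_sub, ← Q.evenPart.invariant, hQ.form_bracket_right,
    map_sub, map_smul, map_smul, smul_eq_mul, smul_eq_mul]
  ring

theorem bracket_eq_left (hQ : Q.IsTriangular Y T a b) : Q.bracket Y T = a := by
  rw [← sub_eq_zero]
  have hm := Q.bracket_mem_odd_odd hQ.left_mem hQ.right_mem
  refine Q.eq_zero_of_even (sub_mem hm a.2) fun v hv => ?_
  rw [Q.form_comm_even (sub_mem hm a.2) hv, map_sub, ← Q.invariant, hQ.act_left ⟨v, hv⟩,
    map_smul, LinearMap.smul_apply, hQ.pair, smul_eq_mul, mul_one]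
  exact sub_self _

theorem bracket_eq_right (hQ : Q.IsTriangular Y T a b) : Q.bracket T T = b := by
  rw [← sub_eq_zero]
  have hm := Q.bracket_mem_odd_odd hQ.right_mem hQ.right_mem
  refine Q.eq_zero_of_even (sub_mem hm b.2) fun v hv => ?_
  rw [Q.form_comm_even (sub_mem hm b.2) hv, map_sub, ← Q.invariant, hQ.act_right ⟨v, hv⟩]
  simp only [map_add, map_smul, LinearMap.add_apply, LinearMap.smul_apply, hQ.pair,
    Q.form_self_odd hQ.right_mem, smul_eq_mul, mul_one, mul_zero, zero_add]
  exact sub_self _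

/-- The Jacobi identity for odd vectors says that `a` and `b` span a totally isotropic subspace. -/
theorem isotropic (hQ : Q.IsTriangular Y T a b) :
    Q.evenPart.form a a = 0 ∧ Q.evenPart.form b a = 0 ∧ Q.evenPart.form b b = 0 := by
  have hTY := (Q.bracket_comm_odd hQ.right_mem hQ.left_mem).trans hQ.bracket_eq_left
  have hTT := Q.form_self_odd hQ.right_mem
  have hYY := Q.form_self_odd hQ.left_mem
  have j1 := Q.jacobi_odd hQ.right_mem hQ.right_mem hQ.right_mem
  have j2 := Q.jacobi_odd hQ.left_mem hQ.right_mem hQ.right_mem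
  rw [hQ.bracket_eq_right, hQ.act_right] at j1
  rw [hQ.bracket_eq_right, hQ.bracket_eq_left, hTY, hQ.act_right, hQ.act_left] at j2
  have e1 := congrArg (Q.form Y ·) j1
  have e2 := congrArg (Q.form · T) j1
  have e3 := congrArg (Q.form Y ·) j2
  simp [hQ.pair, hTT, hYY] at e1 e2 e3
  refine ⟨?_, ?_, ?_⟩
  · exact e3
  · linear_combination -e1 / 3
  · linear_combination e2 / 3

/-- A Witt basis of the even part and a triangular basis of the odd part determine the superalgebra
up to i-isomorphism. -/
theorem iIso (hQ : Q.IsTriangular Y T a b) (h6 : Module.finrank ℂ (Q.part 0) = 6)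
    (h2 : Module.finrank ℂ (Q.part 1) = 2) {f : EvenIdx → Q.part 0} {t : EvenIdx → EvenIdx → V6}
    (hf : Q.evenPart.HasTable f t) (ht : EvenOK t) {d : OddData} (hd : SuperOK t d)
    (hact : ∀ i, d.act i = !![Q.evenPart.form (f i) a, Q.evenPart.form (f i) b;
      0, -Q.evenPart.form (f i) a]) : Q.IIso (super8 t ht d hd) := by
  have : FiniteDimensional ℂ (Q.part 0) := Module.finite_of_finrank_pos (by omega)
  have hYY := Q.form_self_odd hQ.left_mem
  have hTT := Q.form_self_odd hQ.right_mem
  have hTY : Q.form T Y = -1 := by rw [Q.form_skew_odd hQ.right_mem hQ.left_mem, hQ.pair]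
  let φ₀ : V6 →ₗ[ℂ] V := (Q.part 0).subtype ∘ₗ combo f
  let φ₁ : (Fin 2 → ℂ) →ₗ[ℂ] V := Fintype.linearCombination ℂ ![Y, T]
  have hφ₁ : ∀ p, φ₁ p = p 0 • Y + p 1 • T := fun p => by
    simp [φ₁, Fintype.linearCombination_apply, Fin.sum_univ_two]
  have m₀ : ∀ u, φ₀ u ∈ Q.part 0 := fun u => (combo f u).2
  have m₁ : ∀ p, φ₁ p ∈ Q.part 1 := fun p => by
    rw [hφ₁]
    exact add_mem (Submodule.smul_mem _ _ hQ.left_mem) (Submodule.smul_mem _ _ hQ.right_mem)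
  have s₀ : ∀ v ∈ Q.part 0, ∃ u, φ₀ u = v := fun v hv => by
    obtain ⟨u, hu⟩ := hf.witt.combo_surjective h6 ⟨v, hv⟩
    exact ⟨u, congrArg Subtype.val hu⟩
  have s₁ : ∀ v ∈ Q.part 1, ∃ p, φ₁ p = v := fun v hv =>
    ⟨![Q.form v T, Q.form Y v], by
      rw [hφ₁]; exact (eq_combination_of_pair h2 hQ.left_mem hQ.right_mem hQ.pair hv).symm⟩
  have f₀ : ∀ u v, Q.form (φ₀ u) (φ₀ v) = evenForm u v := hf.witt.form_combo
  have f₁ : ∀ p q, Q.form (φ₁ p) (φ₁ q) = oddForm p q := fun p q => by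
    rw [hφ₁, hφ₁, oddForm_apply]
    simp [hYY, hTT, hTY, hQ.pair]
    ring
  have b₀ : ∀ u v, Q.bracket (φ₀ u) (φ₀ v) = φ₀ (evenBracket t u v) := fun u v =>
    congrArg Subtype.val (hf.bracket_combo h6 u v)
  have b₁ : ∀ u p, Q.bracket (φ₀ u) (φ₁ p) = φ₁ (d.ad u p) := by
    intro u p
    have key : (Q.bracket.flip (φ₁ p)) ∘ₗ φ₀ = φ₁ ∘ₗ d.ad.flip p := by
      refine lin_ext fun i => ?_
      have hi : d.ad (e i) p = (d.act i).mulVec p := by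
        rw [OddData.ad_apply, Finset.sum_eq_single i]
        · simp [e_apply]
        · intro j _ hj; simp [e_apply, hj]
        · simp
      have hc : φ₀ (e i) = f i := congrArg Subtype.val (combo_e f i)
      simp only [LinearMap.comp_apply, LinearMap.flip_apply, hi, hc, hact, hφ₁, map_add, map_smul,
        LinearMap.add_apply, LinearMap.smul_apply, hQ.act_left, hQ.act_right]
      simp [Matrix.mulVec, dotProduct, Fin.sum_univ_two]
      module
    exact LinearMap.congr_fun key u
  have b₂ : ∀ p q, Q.bracket (φ₁ p) (φ₁ q) = φ₀ (d.mul p q) := by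
    intro p q
    rw [← sub_eq_zero]
    have hm := sub_mem (Q.bracket_mem_odd_odd (m₁ p) (m₁ q)) (m₀ (d.mul p q))
    refine Q.eq_zero_of_even hm fun v hv => ?_
    obtain ⟨u, rfl⟩ := s₀ v hv
    rw [Q.form_comm_even hm hv, map_sub, ← Q.invariant, b₁, f₁, f₀, hd.invariant, sub_self]
  let φ : V8 →ₗ[ℂ] V := φ₀.coprod φ₁
  have hφ : ∀ x : V8, φ x = φ₀ x.1 + φ₁ x.2 := fun x => LinearMap.coprod_apply _ _ _
  have hform : ∀ x y, Q.form (φ x) (φ y) = superForm x y := fun x y => by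
    rw [hφ, hφ, superForm_apply, ← f₀, ← f₁]
    simp [Q.even _ (m₀ x.1) _ (m₁ y.2), Q.form_odd_even (m₀ y.1) (m₁ x.2)]
  have hbr : ∀ x y, Q.bracket (φ x) (φ y) = φ (superBracket t d x y) := fun x y => by
    rw [hφ, hφ, hφ, superBracket_apply]
    simp only [map_add, map_sub, LinearMap.add_apply, b₀, b₁, b₂,
      Q.skew_odd_even (m₀ y.1) (m₁ x.2)]
    abel
  have hinj : Function.Injective φ := by
    rw [← LinearMap.ker_eq_bot, LinearMap.ker_eq_bot']
    intro x hx
    exact (super8 t ht d hd).nondegenerate x fun y => by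
      change superForm x y = 0
      rw [← hform, hx, map_zero, LinearMap.zero_apply]
  have hsurj : Function.Surjective φ := by
    intro w
    obtain ⟨w₀, h₀, w₁, h₁, rfl⟩ := Submodule.mem_sup.1 (Q.isCompl.sup_eq_top ▸ Submodule.mem_top :
      w ∈ Q.part 0 ⊔ Q.part 1)
    obtain ⟨u, rfl⟩ := s₀ w₀ h₀
    obtain ⟨p, rfl⟩ := s₁ w₁ h₁
    exact ⟨(u, p), hφ _⟩
  have hdisj := Submodule.disjoint_def.1 Q.isCompl.disjoint
  let A := LinearEquiv.ofBijective φ ⟨hinj, hsurj⟩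
  have hA : ∀ x, A x = φ x := fun _ => rfl
  refine ⟨A.symm, fun i X => ?_, fun X X' => ?_, fun X X' => ?_⟩
  · obtain ⟨x, rfl⟩ := A.surjective X
    rw [A.symm_apply_apply, hA]
    change _ ↔ x ∈ part8 i
    obtain rfl | rfl := zmod2_cases i
    · rw [mem_part8_zero]
      constructor
      · intro hx
        have h0 : φ₁ x.2 ∈ Q.part 0 := by
          have := sub_mem hx (m₀ x.1)
          rwa [hφ, add_sub_cancel_left] at this
        have h1 := hdisj _ h0 (m₁ x.2)
        have h3 : φ x = φ (x.1, 0) := by rw [hφ, hφ, h1, map_zero]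
        rw [hinj h3]
      · intro hx
        rw [hφ, hx, map_zero, add_zero]
        exact m₀ _
    · rw [mem_part8_one]
      constructor
      · intro hx
        have h0 : φ₀ x.1 ∈ Q.part 1 := by
          have := sub_mem hx (m₁ x.2)
          rwa [hφ, add_sub_cancel_right] at this
        have h1 := hdisj _ (m₀ x.1) h0
        have h3 : φ x = φ (0, x.2) := by rw [hφ, hφ, h1, map_zero]
        rw [hinj h3]
      · intro hx
        rw [hφ, hx, map_zero, zero_add]
        exact m₁ _
  · obtain ⟨x, rfl⟩ := A.surjective X
    obtain ⟨y, rfl⟩ := A.surjective X'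
    rw [LinearEquiv.symm_apply_eq, A.symm_apply_apply, A.symm_apply_apply]
    exact hbr x y
  · obtain ⟨x, rfl⟩ := A.surjective X
    obtain ⟨y, rfl⟩ := A.surjective X'
    rw [A.symm_apply_apply, A.symm_apply_apply]
    exact (hform x y).symm

end IsTriangular

end QuadraticLieSuperalgebra

/-! ### Decomposability -/

namespace QuadraticLieSuperalgebra

open Quadratic EvenIdx

variable {V : Type*} [AddCommGroup V] [Module ℂ V] {Q : QuadraticLieSuperalgebra V}

/-- If the even part acts trivially on the odd part, then so does the odd part. -/
theorem bracket_odd_eq_zero (h : ∀ u ∈ Q.part 0, ∀ p ∈ Q.part 1, Q.bracket u p = 0) {p q : V}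
    (hp : p ∈ Q.part 1) (hq : q ∈ Q.part 1) : Q.bracket p q = 0 := by
  have hm := Q.bracket_mem_odd_odd hp hq
  refine Q.eq_zero_of_even hm fun u hu => ?_
  rw [Q.form_comm_even hm hu, ← Q.invariant, h u hu p hp, map_zero, LinearMap.zero_apply]

theorem isOrthogonalSum_of_trivial
    (h : ∀ u ∈ Q.part 0, ∀ p ∈ Q.part 1, Q.bracket u p = 0) :
    Q.IsOrthogonalSum (Q.part 0) (Q.part 1) := by
  have hdisj := Submodule.disjoint_def.1 Q.isCompl.disjoint
  have hsum : ∀ X : V, ∃ X₀ ∈ Q.part 0, ∃ X₁ ∈ Q.part 1, X₀ + X₁ = X := fun X =>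
    Submodule.mem_sup.1 (Q.isCompl.sup_eq_top ▸ Submodule.mem_top : X ∈ Q.part 0 ⊔ Q.part 1)
  refine ⟨⟨fun X₀ h₀ X₁ h₁ hX => ?_, fun X Y hY => ?_⟩, ⟨fun X₀ h₀ X₁ h₁ hX => ?_,
    fun X Y hY => ?_⟩, Q.isCompl, Q.even⟩
  · have : X₁ ∈ Q.part 0 := by simpa using sub_mem hX h₀
    exact ⟨h₀, this⟩
  · obtain ⟨X₀, h₀, X₁, h₁, rfl⟩ := hsum X
    rw [map_add, LinearMap.add_apply, Q.skew_odd_even hY h₁, h Y hY X₁ h₁, neg_zero, add_zero]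
    exact Q.bracket_mem_even_even h₀ hY
  · have : X₀ ∈ Q.part 1 := by simpa using sub_mem hX h₁
    exact ⟨this, h₁⟩
  · obtain ⟨X₀, h₀, X₁, h₁, rfl⟩ := hsum X
    rw [map_add, LinearMap.add_apply, h X₀ h₀ Y hY, bracket_odd_eq_zero h h₁ hY, add_zero]
    exact zero_mem _

/-- A decomposable superalgebra with indecomposable even part and two-dimensional odd part has
trivial action of the even part: a non-degenerate graded ideal meets the even part in `0` or in
everything, and likewise the odd part. -/
theorem IsDecomposable.trivial (hdec : Q.IsDecomposable) (hind : Q.evenPart.IsIndecomposable)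
    (h2 : Module.finrank ℂ (Q.part 1) = 2) :
    ∀ u ∈ Q.part 0, ∀ p ∈ Q.part 1, Q.bracket u p = 0 := by
  obtain ⟨I, hI, hnd, hbot, htop⟩ := hdec
  have hsum : ∀ X : V, ∃ X₀ ∈ Q.part 0, ∃ X₁ ∈ Q.part 1, X₀ + X₁ = X := fun X =>
    Submodule.mem_sup.1 (Q.isCompl.sup_eq_top ▸ Submodule.mem_top : X ∈ Q.part 0 ⊔ Q.part 1)
  -- as the odd part is a symplectic plane, it is contained in `I` or meets `I` trivially
  have hodd : (∃ p ∈ Q.part 1, p ∈ I ∧ p ≠ 0) → Q.part 1 ≤ I := by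
    rintro ⟨p, hp, hpI, hp0⟩
    obtain ⟨q, hqI, hpq⟩ : ∃ q ∈ I, Q.form p q ≠ 0 := by
      by_contra! hc
      exact hp0 (hnd p hpI hc)
    obtain ⟨q₀, h₀, q₁, h₁, rfl⟩ := hsum q
    rw [map_add, Q.form_odd_even h₀ hp, zero_add] at hpq
    have hq₁ := (hI.graded _ h₀ _ h₁ hqI).2
    intro w hw
    rw [eq_combination_of_pair h2 hp (Submodule.smul_mem _ (Q.form p q₁)⁻¹ h₁) (by simp [hpq]) hw]
    exact add_mem (Submodule.smul_mem _ _ hpI)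
      (Submodule.smul_mem _ _ (Submodule.smul_mem _ _ hq₁))
  have hcase : I.comap (Q.part 0).subtype = ⊥ ∨ I.comap (Q.part 0).subtype = ⊤ := by
    by_contra! hc
    refine hind.2 ⟨I.comap (Q.part 0).subtype, ⟨?_, fun X Y hY => hI.bracket_mem X Y hY⟩, ?_, hc⟩
    · intro X₀ _ X₁ h₁ hX
      obtain rfl : X₁ = 0 := by simpa [evenPart] using h₁
      rw [add_zero] at hX
      exact ⟨hX, zero_mem _⟩
    · intro X hX hX0
      refine Subtype.ext (hnd X hX fun Y hY => ?_)
      obtain ⟨Y₀, h₀, Y₁, h₁, rfl⟩ := hsum Y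
      rw [map_add, Q.even X X.2 Y₁ h₁, add_zero]
      exact hX0 ⟨Y₀, h₀⟩ (hI.graded _ h₀ _ h₁ hY).1
  have hzero : I.comap (Q.part 0).subtype = ⊥ → ∀ v ∈ Q.part 0, v ∈ I → v = 0 := by
    intro hJ v hv hvI
    have : (⟨v, hv⟩ : Q.part 0) ∈ I.comap (Q.part 0).subtype := hvI
    rw [hJ, Submodule.mem_bot] at this
    exact congrArg Subtype.val this
  intro u hu p hp
  have hup := Q.bracket_mem_even_odd hu hp
  obtain hJ | hJ := hcase
  · have h1I : Q.part 1 ≤ I := by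
      obtain ⟨w, hwI, hw0⟩ := Submodule.exists_mem_ne_zero_of_ne_bot hbot
      obtain ⟨w₀, h₀, w₁, h₁, rfl⟩ := hsum w
      obtain ⟨hw₀, hw₁⟩ := hI.graded _ h₀ _ h₁ hwI
      rw [hzero hJ w₀ h₀ hw₀, zero_add] at hw0
      exact hodd ⟨w₁, h₁, hw₁, hw0⟩
    refine Q.eq_zero_of_odd hup fun q hq => ?_
    rw [Q.invariant, hzero hJ _ (Q.bracket_mem_odd_odd hp hq) (hI.bracket_mem p q (h1I hq)),
      map_zero]
  · have h0I : Q.part 0 ≤ I := fun v hv => by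
      have : (⟨v, hv⟩ : Q.part 0) ∈ I.comap (Q.part 0).subtype := hJ ▸ Submodule.mem_top
      exact this
    by_contra hne
    refine htop (eq_top_iff.2 ?_)
    rw [← Q.isCompl.sup_eq_top]
    refine sup_le h0I (hodd ⟨_, hup, ?_, hne⟩)
    have := hI.bracket_mem p u (h0I hu)
    rw [Q.skew_odd_even hu hp] at this
    exact neg_mem_iff.1 this

theorem IsOrthogonalSum.isDecomposable (h : Q.IsOrthogonalSum (Q.part 0) (Q.part 1))
    (h0 : Q.part 0 ≠ ⊥) (h1 : Q.part 0 ≠ ⊤) : Q.IsDecomposable :=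
  ⟨Q.part 0, h.left_ideal, fun _ hX hX0 => Q.eq_zero_of_even hX hX0, h0, h1⟩

theorem symplecticOn_odd : Q.SymplecticOn (Q.part 1) :=
  ⟨fun _ hX => Q.form_self_odd hX, fun _ hX hX0 => Q.eq_zero_of_odd hX hX0⟩

theorem IsTriangular.trivial (h2 : Module.finrank ℂ (Q.part 1) = 2) {Y T : V}
    (hQ : Q.IsTriangular Y T 0 0) : ∀ u ∈ Q.part 0, ∀ p ∈ Q.part 1, Q.bracket u p = 0 := by
  intro u hu p hp
  have h3 := hQ.act_left ⟨u, hu⟩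
  have h4 := hQ.act_right ⟨u, hu⟩
  simp only [map_zero, neg_zero, zero_smul, add_zero] at h3 h4
  rw [eq_combination_of_pair h2 hQ.left_mem hQ.right_mem hQ.pair hp, map_add, map_smul, map_smul,
    h3, h4, smul_zero, smul_zero, add_zero]

theorem zero_matrix_two : (0 : Matrix (Fin 2) (Fin 2) ℂ) = !![0, 0; 0, 0] := by
  ext i j
  fin_cases i <;> fin_cases j <;> rfl

/-! ### The eight-dimensional superalgebras -/

/-- In `𝔤_{6,1}` the centre is spanned by `Z₁, Z₂, Z₃`. -/
theorem HasTable.form_t61_central {L : Type*} [AddCommGroup L] [Module ℂ L] [FiniteDimensional ℂ L]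
    {Q : QuadraticLieSuperalgebra L} (h6 : Module.finrank ℂ L = 6)
    {f : EvenIdx → L} (hf : Q.HasTable f t61) {a : L} (ha : Q.IsCentral a) :
    Q.form (f Z1) a = 0 ∧ Q.form (f Z2) a = 0 ∧ Q.form (f Z3) a = 0 := by
  have h1 := hf.bracket_combo h6 (e X2) (e X3)
  have h2 := hf.bracket_combo h6 (e X3) (e X1)
  have h3 := hf.bracket_combo h6 (e X1) (e X2)
  have e1 : evenBracket t61 (e X2) (e X3) = e Z1 := by
    rw [t61_bracket]; ext i; cases i <;> simp [e_apply]
  have e2 : evenBracket t61 (e X3) (e X1) = e Z2 := by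
    rw [t61_bracket]; ext i; cases i <;> simp [e_apply]
  have e3 : evenBracket t61 (e X1) (e X2) = e Z3 := by
    rw [t61_bracket]; ext i; cases i <;> simp [e_apply]
  rw [e1] at h1
  rw [e2] at h2
  rw [e3] at h3
  simp only [combo_e] at h1 h2 h3
  exact ⟨by rw [← h1, ha.tri_eq_zero], by rw [← h2, ha.tri_eq_zero], by rw [← h3, ha.tri_eq_zero]⟩

/-- The cyclic symmetry of `𝔤_{6,1}`. -/
theorem HasTable.t61_cyclic {L : Type*} [AddCommGroup L] [Module ℂ L] [FiniteDimensional ℂ L]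
    {Q : QuadraticLieSuperalgebra L} (h6 : Module.finrank ℂ L = 6)
    {f : EvenIdx → L} (hf : Q.HasTable f t61) :
    Q.HasTable (sextuple (f X2) (f X3) (f X1) (f Z2) (f Z3) (f Z1)) t61 := by
  have := hf.change h6 (u := sextuple (e X2) (e X3) (e X1) (e Z2) (e Z3) (e Z1)) (t' := t61)
    (fun v w => by
      simp only [evenForm_apply, combo_apply]
      simp [sextuple, e_apply]
      ring)
    (fun v w => by
      rw [t61_bracket, t61_bracket]
      ext i
      simp only [combo_apply]
      cases i <;> simp [sextuple, e_apply])
  convert this using 1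
  ext i
  cases i <;> simp [sextuple, combo_e]

/-- A vector orthogonal to a Witt basis is zero. -/
theorem IsWitt.eq_zero {L : Type*} [AddCommGroup L] [Module ℂ L] [FiniteDimensional ℂ L]
    {Q : QuadraticLieSuperalgebra L} (h : Q.IsEven) (h6 : Module.finrank ℂ L = 6)
    {f : EvenIdx → L} (hf : Q.IsWitt f) {a : L} (ha : ∀ i, Q.form (f i) a = 0) : a = 0 := by
  refine Q.nondegenerate a fun w => ?_
  obtain ⟨u, rfl⟩ := hf.combo_surjective h6 w
  rw [h.form_comm, combo_apply]
  simp [ha]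

/-- The superalgebras with even part `𝔤_{6,1}`. -/
theorem IsTriangular.classify_t61 (h6 : Module.finrank ℂ (Q.part 0) = 6)
    (h2 : Module.finrank ℂ (Q.part 1) = 2) {Y T : V} {a b : Q.part 0}
    (hQ : Q.IsTriangular Y T a b) (hab : ¬(a = 0 ∧ b = 0)) {f : EvenIdx → Q.part 0}
    (hf : Q.evenPart.HasTable f t61) :
    (∃ l m n : ℂ, ¬(l = 0 ∧ m = 0 ∧ n = 0) ∧ Q.IIso (g821 l m n)) ∨
      ∃ l m : ℂ, Q.IIso (g822 l m) := by
  have : FiniteDimensional ℂ (Q.part 0) := Module.finite_of_finrank_pos (by omega)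
  have h := Q.evenPart_isEven
  by_cases ha : a = 0
  · subst ha
    right
    have hb : Q.evenPart.IsCentral b := fun v => by
      rw [hQ.bracket_right, smul_zero, map_zero, mul_zero, zero_smul, sub_zero]
    have hb0 : b ≠ 0 := fun hb0 => hab ⟨rfl, hb0⟩
    obtain ⟨f, hf, hn⟩ : ∃ f, Q.evenPart.HasTable f t61 ∧ Q.evenPart.form (f X3) b ≠ 0 := by
      by_contra! hc
      obtain ⟨z1, z2, z3⟩ := hf.form_t61_central h6 hb
      refine hb0 (hf.witt.eq_zero h h6 fun i => ?_)
      have c2 := hf.t61_cyclic h6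
      cases i
      · exact hc _ c2
      · exact hc _ (c2.t61_cyclic h6)
      · exact hc _ hf
      · exact z1
      · exact z2
      · exact z3
    obtain ⟨z1, z2, z3⟩ := hf.form_t61_central h6 hb
    obtain ⟨c, hc⟩ := IsAlgClosed.exists_pow_nat_eq (Q.evenPart.form (f X3) b) (n := 2)
      (by norm_num)
    have hc0 : c ≠ 0 := by rintro rfl; simp at hc; exact hn hc.symm
    have hQ' := hQ.change hc0 0
    refine ⟨c⁻¹ ^ 2 * Q.evenPart.form (f X1) b, c⁻¹ ^ 2 * Q.evenPart.form (f X2) b,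
      hQ'.iIso h6 h2 hf _ _ fun i => ?_⟩
    cases i <;> simp only [map_add, map_smul, z1, z2, z3, d822, ← hc] <;> simp [hc0, zero_matrix_two]
  · left
    obtain ⟨v, hv⟩ : ∃ v, Q.evenPart.form v a = 1 / 2 := by
      obtain ⟨w, hw⟩ : ∃ w, Q.evenPart.form w a ≠ 0 := by
        by_contra! hc
        exact ha (Q.evenPart.nondegenerate a fun w => by rw [h.form_comm, hc])
      exact ⟨(1 / 2 * (Q.evenPart.form w a)⁻¹) • w, by simp [hw]⟩
    -- modulo `a`, the nilpotent operator `ad v` multiplies `b` by `-1`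
    have hb1 := hQ.bracket_right v
    rw [hv] at hb1
    have hcen : Q.evenPart.bracket v (Q.evenPart.bracket v b) = 0 := by
      obtain ⟨v, rfl⟩ := hf.witt.combo_surjective h6 v
      obtain ⟨b, rfl⟩ := hf.witt.combo_surjective h6 b
      rw [hf.bracket_combo h6, hf.bracket_combo h6]
      convert map_zero (combo f)
      rw [t61_bracket, t61_bracket]
      ext i
      cases i <;> simp
    have hb2 : b = (2 * Q.evenPart.form v b) • a := by
      have h3 := hcen
      rw [hb1, map_sub, map_smul, hQ.isCentral_left, smul_zero, zero_sub, map_smul,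
        neg_eq_zero] at h3
      norm_num at h3
      rw [h3] at hb1
      norm_num at hb1
      exact (sub_eq_zero.1 hb1.symm).symm
    have hQ' := hQ.change one_ne_zero (-Q.evenPart.form v b)
    have hb3 : ((1 : ℂ)⁻¹ ^ 2) • b + (2 * -Q.evenPart.form v b * (1 : ℂ)⁻¹) • a = 0 := by
      rw [inv_one, one_pow, one_smul, mul_one, mul_neg, neg_smul, ← hb2, add_neg_cancel]
    rw [hb3] at hQ'
    obtain ⟨z1, z2, z3⟩ := hf.form_t61_central h6 hQ.isCentral_left
    refine ⟨Q.evenPart.form (f X1) a, Q.evenPart.form (f X2) a, Q.evenPart.form (f X3) a, ?_,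
      hQ'.iIso h6 h2 hf _ _ fun i => ?_⟩
    · rintro ⟨x1, x2, x3⟩
      refine ha (hf.witt.eq_zero h h6 fun i => ?_)
      cases i <;> assumption
    · cases i <;> simp [d821, z1, z2, z3, zero_matrix_two]

/-- The superalgebras whose even part is a double extension of an abelian algebra. -/
theorem IsTriangular.classify_doubleExtension (h6 : Module.finrank ℂ (Q.part 0) = 6)
    (h2 : Module.finrank ℂ (Q.part 1) = 2) {Y T : V} {a b : Q.part 0}
    (hQ : Q.IsTriangular Y T a b) (hab : ¬(a = 0 ∧ b = 0)) {x z : Q.part 0}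
    (hD : Q.evenPart.IsDoubleExtension x z) :
    (∃ l : ℂ, l ≠ 0 ∧ Q.IIso (g823 l)) ∨
      (∃ l m : ℂ, l ≠ 0 ∧ m ≠ 0 ∧ Q.IIso (g824 l m)) ∨
      (∃ l : ℂ, l ≠ 0 ∧ Q.IIso (g825 l)) ∨
      Q.IIso g827 ∨
      (∃ l : ℂ, l ≠ 0 ∧ Q.IIso (g828 l)) ∨
      Q.IIso g829 := by
  have : FiniteDimensional ℂ (Q.part 0) := Module.finite_of_finrank_pos (by omega)
  have h := Q.evenPart_isEven
  obtain ⟨α, rfl⟩ := hD.eq_smul a hQ.isCentral_left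
  by_cases hα : α = 0
  · subst hα
    rw [zero_smul] at hQ hab
    obtain ⟨β, rfl⟩ := hD.eq_smul b fun v => by
      rw [hQ.bracket_right, smul_zero, map_zero, mul_zero, zero_smul, sub_zero]
    obtain ⟨f, ⟨c, hc, rfl⟩, hf⟩ := hD.exists_hasTable h h6
    have hβ : β ≠ 0 := by rintro rfl; exact hab ⟨rfl, zero_smul _ _⟩
    obtain ⟨r, hr⟩ := IsAlgClosed.exists_pow_nat_eq (β * c) (n := 2) (by norm_num)
    have hr0 : r ≠ 0 := by
      rintro rfl
      exact mul_ne_zero hβ hc (by rw [← hr]; ring)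
    have hQ' := hQ.change hr0 0
    have hb : (r⁻¹ ^ 2) • β • c • f Z3 + (2 * 0 * r⁻¹) • (0 : Q.part 0) = f Z3 := by
      rw [smul_zero, add_zero, smul_smul, smul_smul, mul_assoc, ← hr, ← mul_pow,
        inv_mul_cancel₀ hr0, one_pow, one_smul]
    rw [hb] at hQ'
    have hact : Q.evenPart.IsWitt f → ∀ i, dNil.act i = !![Q.evenPart.form (f i) 0,
        Q.evenPart.form (f i) (f Z3); 0, -Q.evenPart.form (f i) 0] := by
      intro hw i
      rw [hw i Z3, evenForm_apply]
      cases i <;> simp [dNil, e_apply, zero_matrix_two]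
    obtain ⟨l, hl, hf⟩ | hf := hf
    · exact Or.inl ⟨l, hl, hQ'.iIso h6 h2 hf _ _ (hact hf.witt)⟩
    · exact Or.inr (Or.inr (Or.inr (Or.inl (hQ'.iIso h6 h2 hf _ _ (hact hf.witt)))))
  · -- a shift of `T` makes `b` orthogonal to `x`
    obtain ⟨T', b', hQ', hxb⟩ : ∃ T' b', Q.IsTriangular Y T' (α • z) b' ∧
        Q.evenPart.form x b' = 0 := by
      refine ⟨_, _, by simpa using hQ.change one_ne_zero (-Q.evenPart.form x b / (2 * α)), ?_⟩
      simp [hD.form_pair]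
      field_simp
      ring
    have hzb : Q.evenPart.form z b' = 0 := by
      have := hQ'.isotropic.2.1
      rw [map_smul, smul_eq_mul, mul_eq_zero] at this
      rw [h.form_comm]
      exact this.resolve_left hα
    by_cases hb0 : b' = 0
    · subst hb0
      obtain ⟨f, ⟨c, hc, rfl⟩, hf⟩ := hD.exists_hasTable h h6
      have hact : Q.evenPart.IsWitt f → ∀ i, (dDiag (α * c)).act i =
          !![Q.evenPart.form (f i) (α • c • f Z3), Q.evenPart.form (f i) 0;
            0, -Q.evenPart.form (f i) (α • c • f Z3)] := by
        intro hw i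
        rw [map_smul, map_smul, hw i Z3, evenForm_apply]
        cases i <;> simp [dDiag, e_apply, zero_matrix_two]
      obtain ⟨l, hl, hf⟩ | hf := hf
      · exact Or.inr (Or.inl ⟨l, α * c, hl, mul_ne_zero hα hc,
          hQ'.iIso h6 h2 hf _ _ (hact hf.witt)⟩)
      · exact Or.inr (Or.inr (Or.inr (Or.inr (Or.inl ⟨α * c, mul_ne_zero hα hc,
          hQ'.iIso h6 h2 hf _ _ (hact hf.witt)⟩))))
    · -- `b` is an eigenvector of `ad x`; the eigenvalue is normalised to `-1`
      have h2α : (2 * α)⁻¹ ≠ 0 := inv_ne_zero (mul_ne_zero two_ne_zero hα)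
      have hD' := hD.rescale h2α
      have hbS : b' ∈ Q.evenPart.hypCompl ⊤ ((2 * α)⁻¹ • x) ((2 * α)⁻¹⁻¹ • z) :=
        mem_hypCompl.2 ⟨Submodule.mem_top, by simp [hxb], by simp [hzb]⟩
      have hev : Q.evenPart.bracket ((2 * α)⁻¹ • x) b' = -b' := by
        simp only [hQ'.bracket_right, map_smul, LinearMap.smul_apply, hxb, hD.form_pair,
          smul_eq_mul, mul_one, mul_zero, zero_smul, zero_sub]
        rw [smul_neg, smul_smul, inv_mul_cancel₀ (mul_ne_zero two_ne_zero hα), one_smul]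
      obtain ⟨f, -, hz, hf⟩ := hD'.hasTable_t62_or_t63 h h6 hbS hb0 hev
      have ha : α • z = (1 / 2 : ℂ) • f Z3 := by
        rw [hz, smul_smul, inv_inv]
        congr 1
        ring
      rw [ha] at hQ'
      obtain ⟨l, hl, hf, hfb⟩ | ⟨hf, hfb⟩ := hf
      · refine Or.inr (Or.inr (Or.inl ⟨l, hl, hQ'.iIso h6 h2 hf _ _ fun i => ?_⟩))
        rw [map_smul, ← hfb, hf.witt i Z3, hf.witt i X1, evenForm_apply, evenForm_apply]
        cases i <;> simp [d825, e_apply, zero_matrix_two]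
        norm_num
      · refine Or.inr (Or.inr (Or.inr (Or.inr (Or.inr (hQ'.iIso h6 h2 hf _ _ fun i => ?_)))))
        rw [map_smul, ← hfb, hf.witt i Z3, hf.witt i X2, evenForm_apply, evenForm_apply]
        cases i <;> simp [d829, e_apply, zero_matrix_two]
        norm_num

end QuadraticLieSuperalgebra

theorem theorem3p3p2 {V : Type*} [AddCommGroup V] [Module ℂ V]
    (𝔤 : QuadraticLieSuperalgebra V)
    (hdim : Module.finrank ℂ V = 8)
    (hsolv : 𝔤.IsSolvable)
    (heven : Module.finrank ℂ (𝔤.part 0) = 6)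
    (hindec : 𝔤.evenPart.IsIndecomposable) :
    (𝔤.IsDecomposable →
      𝔤.IsOrthogonalSum (𝔤.part 0) (𝔤.part 1) ∧
      (𝔤.evenPart.IIso Quadratic.g61 ∨
        (∃ l : ℂ, l ≠ 0 ∧ 𝔤.evenPart.IIso (Quadratic.g62 l)) ∨
        𝔤.evenPart.IIso Quadratic.g63) ∧
      Module.finrank ℂ (𝔤.part 1) = 2 ∧
      𝔤.SymplecticOn (𝔤.part 1) ∧
      (∀ X ∈ 𝔤.part 0, ∀ Y ∈ 𝔤.part 1, 𝔤.bracket X Y = 0)) ∧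
    (𝔤.IsIndecomposable →
      (∃ l m n : ℂ, ¬(l = 0 ∧ m = 0 ∧ n = 0) ∧ 𝔤.IIso (Quadratic.g821 l m n)) ∨
      (∃ l m : ℂ, 𝔤.IIso (Quadratic.g822 l m)) ∨
      (∃ l : ℂ, l ≠ 0 ∧ 𝔤.IIso (Quadratic.g823 l)) ∨
      (∃ l m : ℂ, l ≠ 0 ∧ m ≠ 0 ∧ 𝔤.IIso (Quadratic.g824 l m)) ∨
      (∃ l : ℂ, l ≠ 0 ∧ 𝔤.IIso (Quadratic.g825 l)) ∨
      (∃ m : ℂ, m ≠ 0 ∧ 𝔤.IIso (Quadratic.g826 m)) ∨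
      𝔤.IIso Quadratic.g827 ∨
      (∃ l : ℂ, l ≠ 0 ∧ 𝔤.IIso (Quadratic.g828 l)) ∨
      𝔤.IIso Quadratic.g829) := by
  have : FiniteDimensional ℂ V := Module.finite_of_finrank_pos (by omega)
  have h2 : Module.finrank ℂ (𝔤.part 1) = 2 := by
    have := Submodule.finrank_add_eq_of_isCompl 𝔤.isCompl
    omega
  have h0 : 𝔤.part 0 ≠ ⊥ := by
    intro h
    rw [h, finrank_bot] at heven
    omega
  have h1 : 𝔤.part 0 ≠ ⊤ := by
    intro h
    rw [h, finrank_top] at heven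
    omega
  have hperf := 𝔤.evenPart_not_perfect hsolv h0
  have hE := 𝔤.evenPart_isEven
  refine ⟨fun hdec => ?_, fun hind => ?_⟩
  · have htriv := hdec.trivial hindec h2
    exact ⟨QuadraticLieSuperalgebra.isOrthogonalSum_of_trivial htriv,
      hE.iIso_of_not_perfect hindec heven hperf, h2,
      QuadraticLieSuperalgebra.symplecticOn_odd, htriv⟩
  · obtain ⟨Y, T, a, b, hQ⟩ := QuadraticLieSuperalgebra.exists_isTriangular hsolv h2
    have hab : ¬(a = 0 ∧ b = 0) := by
      rintro ⟨rfl, rfl⟩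
      exact hind.2 ((QuadraticLieSuperalgebra.isOrthogonalSum_of_trivial
        (hQ.trivial h2)).isDecomposable h0 h1)
    obtain ⟨f, hf⟩ | ⟨x, z, hD⟩ := hE.hasTable_t61_or_isDoubleExtension hindec heven hperf
    · exact (hQ.classify_t61 heven h2 hab hf).imp_right Or.inl
    · obtain h | h | h | h | h | h := hQ.classify_doubleExtension heven h2 hab hD
      · exact Or.inr (Or.inr (Or.inl h))
      · exact Or.inr (Or.inr (Or.inr (Or.inl h)))
      · exact Or.inr (Or.inr (Or.inr (Or.inr (Or.inl h))))
      · exact Or.inr (Or.inr (Or.inr (Or.inr (Or.inr (Or.inr (Or.inl h))))))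
      · exact Or.inr (Or.inr (Or.inr (Or.inr (Or.inr (Or.inr (Or.inr (Or.inl h)))))))
      · exact Or.inr (Or.inr (Or.inr (Or.inr (Or.inr (Or.inr (Or.inr (Or.inr h)))))))
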